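/- Notation. For $\alpha,\gamma_1,\gamma_2\in\mathbb{R}$ with $\gamma_1>\gamma_2$ and $\varepsilon\in(-1,1)$ let $$Q_R=Q_{R,\varepsilon}=\tfrac12\bigl(x^2-\partial_x^2\bigr)I_2+\alpha x\begin{pmatrix}0&1\\1&0\end{pmatrix}+\varepsilon\begin{pmatrix}\gamma_1&0\\0&\gamma_2\end{pmatrix}$$ in $L^2(\mathbb{R};\mathbb{C}^2)$ with its maximal domain $\{u\in L^2:\ Q_Ru\in L^2\}$ ($Q_Ru$ in the sense of tempered distributions). The parity operator is $(\Pi u)(x)=\mathrm{diag}(1,-1)\,u(-x)$, and $u$ has parity $p=\pm1$ if $\Pi u=p\,u$. Let $L_k(x)=\sum_{j=0}^k(-1)^j\binom kj\frac{x^j}{j!}$ be the Laguerre polynomials and $\mathsf{Z}=\{x\ge 0:\ L_k(x)=0\text{ for some }k\in\mathbb{N}\}$. Let $I_N=[N,N+1)$, $N=0,1,2,\dots$; a shifted eigenvalue is $\lambda+\alpha^2/2$ with $\lambda$ an eigenvalue of $Q_R$. Let $\varphi_N=\bigl((x-\partial_x)/\sqrt2\bigr)^Ne^{-x^2/2}$,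 $T_\pm u=u(\cdot\mp\alpha)$, and $$\mu_{N,\pm}=\frac{\gamma_1+\gamma_2}{2}\pm\frac{\gamma_1-\gamma_2}{2}\,\frac{|(T_+\varphi_N,T_-\varphi_N)_{L^2}|}{\|\varphi_N\|_{L^2}^2}.$$ Braak's conjecture on $I_0,\dots,I_K$ is the assertion that, for each parity and counting multiplicities: each $I_N$ with $N\le K$ contains at most two shifted eigenvalues of that parity; no two adjacent intervals $I_N,I_{N+1}$ ($N+1\le K$) both contain none; and no two adjacent intervals $I_N,I_{N+1}$ ($N+1\le K$) both contain two. Statement. Let $\alpha\in\mathbb{R}$ with $4\alpha^2\in(0,+\infty)\setminus\mathsf{Z}$. There is a strictly increasing sequence of integers $k_j\ge 0$ (hence $k_j\nearrow+\infty$), depending only on $\alpha$, such that for all $\gamma_1>\gamma_2$ and every $j$ there is $c_j\in(0,1)$ with the following properties. (i) For all $|\varepsilon|<c_j$, Braak's conjecture holds for $Q_{R,\varepsilon}$ on $I_0,\dots,I_{k_j}$. (ii) There are real-analytic functions $\lambda_{N,\pm}:(-c_j,c_j)\to\mathbb{R}$, $N=0,\dots,k_j$, with $$\lambda_{N,\pm}(\varepsilon)=N+\tfrac12+\mu_{N,\pm}\,\varepsilon+o(\varepsilon)\qquad(\varepsilon\to0),$$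 such that for all $|\varepsilon|<c_j$: no real point of $\mathrm{Spec}(Q_{R,\varepsilon})$ is smaller than $-\alpha^2/2$, and for each $N=0,\dots,k_j$ $$\mathrm{Spec}(Q_{R,\varepsilon})\cap\bigl(I_N-\tfrac{\alpha^2}{2}\bigr)=\bigl\{\lambda_{N,+}(\varepsilon)-\tfrac{\alpha^2}{2},\ \lambda_{N,-}(\varepsilon)-\tfrac{\alpha^2}{2}\bigr\};$$ these points are eigenvalues, their total multiplicity is exactly $2$, and they are distinct if $\varepsilon\ne0$ and $(T_+\varphi_N,T_-\varphi_N)_{L^2}\neq0$. -/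

import Mathlib

open MeasureTheory Set
open scoped SchwartzMap ENNReal

noncomputable section

namespace QRM

/-! ### Laguerre polynomials and Hermite functions -/

/-- The Laguerre polynomial `L_N(x) = ∑_{j ≤ N} (-1)^j (N choose j) x^j / j!`. -/
def laguerre (N : ℕ) (x : ℝ) : ℝ :=
  ∑ j ∈ Finset.range (N + 1), (-1) ^ j * (N.choose j : ℝ) * x ^ j / (j.factorial : ℝ)

/-- The set of all the zeros in `[0, ∞)` of all the Laguerre polynomials. -/
def laguerreZeros : Set ℝ := {x | 0 ≤ x ∧ ∃ k : ℕ, laguerre k x = 0}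

/-- The Hermite functions `φ_N = ((x - ∂_x)/√2)^N e^{-x²/2}`. -/
def hermiteFun : ℕ → ℝ → ℝ
  | 0 => fun x => Real.exp (-x ^ 2 / 2)
  | N + 1 => fun x => (x * hermiteFun N x - deriv (hermiteFun N) x) / √2

/-- `(T₊ φ_N, T₋ φ_N)₀` with `T_± u = u(· ∓ α)` (the Hermite functions are real). -/
def overlap (α : ℝ) (N : ℕ) : ℝ := ∫ x : ℝ, hermiteFun N (x - α) * hermiteFun N (x + α)

/-- `‖φ_N‖₀²`. -/
def hermiteNormSq (N : ℕ) : ℝ := ∫ x : ℝ, hermiteFun N x ^ 2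

/-- `μ_± = β₁ ± β₂ |(T₊ φ_N, T₋ φ_N)₀| / ‖φ_N‖₀²`, where `β₁ = (γ₁ + γ₂)/2`,
`β₂ = (γ₁ - γ₂)/2`, and the sign is `s = ±1`. -/
def firstOrderCoeff (α γ₁ γ₂ : ℝ) (s : ℤˣ) (N : ℕ) : ℝ :=
  (γ₁ + γ₂) / 2 + ((s : ℤ) : ℝ) * ((γ₁ - γ₂) / 2) * (|overlap α N| / hermiteNormSq N)

/-! ### The operator `Q_R` -/

/-- `ℂ²` with its Hermitian norm. -/
abbrev C2 : Type := EuclideanSpace ℂ (Fin 2)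

/-- `L²(ℝ; ℂ²)`. -/
abbrev L2 : Type := Lp C2 2 (volume : Measure ℝ)

/-- A constant matrix acting on `ℂ²`-valued tempered distributions. -/
def matrixAct (M : Matrix (Fin 2) (Fin 2) ℂ) : 𝓢'(ℝ, C2) →L[ℂ] 𝓢'(ℝ, C2) :=
  PointwiseConvergenceCLM.postcomp _ (Matrix.toEuclideanCLM (𝕜 := ℂ) M)

/-- The differential expression
`Q_R = ((x² - ∂²)/2) I₂ + α x [[0,1],[1,0]] + ε diag(γ₁, γ₂)`
acting on `ℂ²`-valued tempered distributions. -/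
def rabiDistrib (α γ₁ γ₂ ε : ℝ) : 𝓢'(ℝ, C2) →L[ℂ] 𝓢'(ℝ, C2) :=
  (1 / 2 : ℂ) • (TemperedDistribution.smulLeftCLM C2 (fun x : ℝ => (x : ℂ) ^ 2)
      - TemperedDistribution.derivCLM C2 ∘L TemperedDistribution.derivCLM C2)
    + (α : ℂ) • (matrixAct !![0, 1; 1, 0] ∘L
        TemperedDistribution.smulLeftCLM C2 (fun x : ℝ => (x : ℂ)))
    + (ε : ℂ) • matrixAct !![(γ₁ : ℂ), 0; 0, (γ₂ : ℂ)]

/-- The pairs `(u, f)` of elements of `L²` with `Q_R u = f` as tempered distributions. -/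
def rabiGraph (α γ₁ γ₂ ε : ℝ) : Submodule ℂ (L2 × L2) :=
  LinearMap.eqLocus
    ((rabiDistrib α γ₁ γ₂ ε ∘L Lp.toTemperedDistributionCLM C2 volume 2 :
        L2 →L[ℂ] 𝓢'(ℝ, C2)).toLinearMap ∘ₗ LinearMap.fst ℂ L2 L2)
    ((Lp.toTemperedDistributionCLM C2 volume 2 : L2 →L[ℂ] 𝓢'(ℝ, C2)).toLinearMap ∘ₗ
      LinearMap.snd ℂ L2 L2)

theorem mem_rabiGraph {α γ₁ γ₂ ε : ℝ} {u f : L2} :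
    (u, f) ∈ rabiGraph α γ₁ γ₂ ε ↔
      rabiDistrib α γ₁ γ₂ ε (u : 𝓢'(ℝ, C2)) = (f : 𝓢'(ℝ, C2)) := Iff.rfl

theorem rabiGraph_functional (α γ₁ γ₂ ε : ℝ) (x : L2 × L2) (hx : x ∈ rabiGraph α γ₁ γ₂ ε)
    (h0 : x.1 = 0) : x.2 = 0 := by
  have h : rabiDistrib α γ₁ γ₂ ε (Lp.toTemperedDistributionCLM C2 volume 2 x.1)
      = Lp.toTemperedDistributionCLM C2 volume 2 x.2 := hx
  rw [h0, map_zero, map_zero] at h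
  have hk := Lp.ker_toTemperedDistributionCLM_eq_bot (E := ℝ) (F := C2) (μ := volume) (p := 2)
  exact (LinearMap.ker_eq_bot'.mp hk) x.2 h.symm

/-- `Q_R` as an unbounded operator in `L²(ℝ; ℂ²)` with its maximal domain
`{u ∈ L² ; Q_R u ∈ L²}`. -/
def rabi (α γ₁ γ₂ ε : ℝ) : L2 →ₗ.[ℂ] L2 := (rabiGraph α γ₁ γ₂ ε).toLinearPMap

theorem mem_graph_rabi {α γ₁ γ₂ ε : ℝ} {u f : L2} :
    (u, f) ∈ (rabi α γ₁ γ₂ ε).graph ↔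
      rabiDistrib α γ₁ γ₂ ε (u : 𝓢'(ℝ, C2)) = (f : 𝓢'(ℝ, C2)) := by
  rw [rabi, Submodule.toLinearPMap_graph_eq _ (rabiGraph_functional α γ₁ γ₂ ε), mem_rabiGraph]

/-! ### Spectrum, eigenspaces, multiplicities -/

/-- The resolvent set of an unbounded operator `T`: the `z` for which `T - z` is a bijection from
the domain onto the space, with bounded inverse `R`. -/
def resolventSet (T : L2 →ₗ.[ℂ] L2) : Set ℂ :=
  {z | ∃ R : L2 →L[ℂ] L2,
    (∀ f : L2, ∃ h : R f ∈ T.domain, T ⟨R f, h⟩ - z • R f = f) ∧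
    ∀ u : T.domain, R (T u - z • (u : L2)) = u}

/-- The spectrum of an unbounded operator. -/
def spec (T : L2 →ₗ.[ℂ] L2) : Set ℂ := (resolventSet T)ᶜ

/-- The eigenspace `Ker (T - z)` of an unbounded operator. -/
def eigenspace (T : L2 →ₗ.[ℂ] L2) (z : ℂ) : Submodule ℂ L2 :=
  (LinearMap.ker (T.toFun - z • T.domain.subtype)).map T.domain.subtype

/-- The number, counted with multiplicity, of eigenvalues of `T` in `I ⊆ ℝ` with eigenvectors in
`S` (a reducing subspace): the dimension of the span of these eigenvectors. -/
def eigenCount (T : L2 →ₗ.[ℂ] L2) (S : Submodule ℂ L2) (I : Set ℝ) : ℕ∞ :=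
  Cardinal.toENat (Module.rank ℂ ↥(⨆ x ∈ I, eigenspace T ((x : ℝ) : ℂ) ⊓ S))

/-! ### Parity and the conjecture -/

/-- The parity operator `(Π u)(x) = diag(1, -1) u(-x)`. -/
def parityOp : L2 →ₗ[ℂ] L2 :=
  ((Matrix.toEuclideanCLM (𝕜 := ℂ) !![1, 0; 0, -1] : C2 →L[ℂ] C2).compLpL 2
      (volume : Measure ℝ)).toLinearMap ∘ₗ
    Lp.compMeasurePreservingₗ ℂ (fun x : ℝ => -x) (Measure.measurePreserving_neg volume)

/-- The vectors of parity `p = ±1`. -/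
def paritySector (p : ℤˣ) : Submodule ℂ L2 :=
  LinearMap.ker (parityOp - (((p : ℤ) : ℂ)) • LinearMap.id)

/-- `I_N - α²/2`, where `I_N = [N, N + 1)`. -/
def shiftedInterval (α : ℝ) (N : ℕ) : Set ℝ :=
  Ico ((N : ℝ) - α ^ 2 / 2) ((N : ℝ) + 1 - α ^ 2 / 2)

/-- The number of shifted eigenvalues `λ + α²/2` of parity `p` in `I_N`. -/
def parityCount (α γ₁ γ₂ ε : ℝ) (p : ℤˣ) (N : ℕ) : ℕ∞ :=
  eigenCount (rabi α γ₁ γ₂ ε) (paritySector p) (shiftedInterval α N)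

/-- Braak's conjecture on the initial segment `I_0, …, I_K`: for each parity, every interval holds
at most two shifted eigenvalues, no two adjacent intervals hold none, and no two adjacent intervals
hold two. -/
structure BraakUpTo (α γ₁ γ₂ ε : ℝ) (K : ℕ) : Prop where
  le_two : ∀ p : ℤˣ, ∀ N ≤ K, parityCount α γ₁ γ₂ ε p N ≤ 2
  not_adjacent_zero : ∀ p : ℤˣ, ∀ N, N + 1 ≤ K →
    ¬ (parityCount α γ₁ γ₂ ε p N = 0 ∧ parityCount α γ₁ γ₂ ε p (N + 1) = 0)
  not_adjacent_two : ∀ p : ℤˣ, ∀ N, N + 1 ≤ K →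
    ¬ (parityCount α γ₁ γ₂ ε p N = 2 ∧ parityCount α γ₁ γ₂ ε p (N + 1) = 2)

/-- The real points of the spectrum of `Q_R`. -/
def rabiSpec (α γ₁ γ₂ ε : ℝ) : Set ℝ := {x | (x : ℂ) ∈ spec (rabi α γ₁ γ₂ ε)}

end QRM

end

/-! At `ε = 0` the combinations `u₀ ± u₁` decouple the system, and completing the square turns it
into two harmonic oscillators centred at `∓α` and lowered by `α²/2`. Completeness of the Hermite
functions then gives a Hilbert basis of eigenvectors (`eigenBasis`), two for each level `N + 1/2 -
α²/2`. A tempered-distribution argument (`rabiDistrib_zero_iff`) identifies the operator on its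
maximal domain with the diagonal operator in that basis.

Every level is the midpoint of its shifted interval, at distance 1 from its neighbours, and the
perturbation `ε diag(γ₁, γ₂)` is bounded. It also commutes with parity, which takes opposite values
on the two eigenvectors of a level. The Lyapunov–Schmidt reduction at level `N` therefore gives two
independent scalar equations `secular = 0` instead of a 2×2 determinant, and no degenerate
perturbation theory is needed (`diagEq_zero_iff`, `exists_resolvent_of_secular_ne_zero`).

For small `ε` each scalar equation has exactly one root in the closed window `|ζ| ≤ 1/2`. A
contraction estimate gives uniqueness (`eq_of_secular_eq_zero`), and the implicit function theorem
gives existence and analyticity (`exists_branch`). The slope at `0` is the diagonal matrix element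
of `diag(γ₁, γ₂)`, which the overlap integral computes (`inner_eigenVec_diagOp`). Each interval thus
holds exactly one eigenvalue of each parity, so all counts in Braak's conjecture equal 1. An initial
segment involves finitely many levels, so one positive bound on `ε` serves all of them. -/

noncomputable section

namespace QRM

/-! ### Lyapunov–Schmidt reduction for a bounded perturbation of a diagonal operator. -/

section Abstract

variable {H : Type*} [NormedAddCommGroup H] [InnerProductSpace ℂ H]

local notation "⟪" x ", " y "⟫" => inner ℂ x y

/-- The bounded operator that is diagonal in a Hilbert basis, with bounded eigenvalues `a`. -/
def diagCLM {ι : Type*} (b : HilbertBasis ι ℂ H) (a : ι → ℂ) (K : ℝ) (hK : 0 ≤ K)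
    (ha : ∀ i, ‖a i‖ ≤ K) : H →L[ℂ] H :=
  (b.repr.symm : _ →L[ℂ] H) ∘L
    (lp.mapCLM 2 (fun i => a i • ContinuousLinearMap.id ℂ ℂ) hK (fun i => by
      rw [norm_smul, ContinuousLinearMap.norm_id, mul_one]; exact ha i)) ∘L
    (b.repr : H →L[ℂ] _)

theorem inner_diagCLM {ι : Type*} (b : HilbertBasis ι ℂ H) (a : ι → ℂ) (K : ℝ) (hK : 0 ≤ K)
    (ha : ∀ i, ‖a i‖ ≤ K) (u : H) (i : ι) :
    ⟪b i, diagCLM b a K hK ha u⟫ = a i * ⟪b i, u⟫ := by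
  rw [← b.repr_apply_apply, ← b.repr_apply_apply]
  simp [diagCLM]

theorem norm_diagCLM_le {ι : Type*} (b : HilbertBasis ι ℂ H) (a : ι → ℂ) (K : ℝ) (hK : 0 ≤ K)
    (ha : ∀ i, ‖a i‖ ≤ K) : ‖diagCLM b a K hK ha‖ ≤ K := by
  refine ContinuousLinearMap.opNorm_le_bound _ hK fun u => ?_
  have h := (lp.mapCLM 2 (fun i => a i • ContinuousLinearMap.id ℂ ℂ) hK (fun i => by
      rw [norm_smul, ContinuousLinearMap.norm_id, mul_one]; exact ha i)).le_of_opNorm_le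
      (lp.norm_mapCLM_le _ _ hK _) (b.repr u)
  simpa [diagCLM] using h

theorem hilbertBasis_ext {ι : Type*} (b : HilbertBasis ι ℂ H) {u v : H}
    (h : ∀ i, ⟪b i, u⟫ = ⟪b i, v⟫) : u = v := by
  apply b.repr.injective
  ext i
  simpa [b.repr_apply_apply] using h i

/-- `P` is not assumed self-adjoint, so it is not moved across the inner product: `u` is expanded in
the basis and continuity of `P` is used. -/
theorem inner_of_eigenbasis {ι : Type*} (b : HilbertBasis ι ℂ H) (P : H →L[ℂ] H) (p : ι → ℂ)
    (hP : ∀ i, P (b i) = p i • b i) (i : ι) (u : H) : ⟪b i, P u⟫ = p i * ⟪b i, u⟫ := by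
  classical
  have h := (innerSL ℂ (b i)).hasSum (P.hasSum (b.hasSum_repr u))
  refine HasSum.unique h ?_
  have hz : ∀ j, j ≠ i → (innerSL ℂ (b i)) (P (b.repr u j • b j)) = 0 := by
    intro j hj
    simp [hP, b.orthonormal.2 hj.symm]
  have hi : innerSL ℂ (b i) (P (b.repr u i • b i)) = p i * ⟪b i, u⟫ := by
    simp [hP, b.repr_apply_apply, b.orthonormal.1 i]
    ring
  rw [← hi]
  exact hasSum_single i hz

variable (b : HilbertBasis (ℕ × ℤˣ) ℂ H) (N : ℕ)

/-- `((Λ - N) + X) u = f`, where `Λ` is the diagonal operator with the eigenvalues `n` on the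
vectors `b (n, s)`. -/
def DiagEq (X : H →L[ℂ] H) (u f : H) : Prop :=
  ∀ k, ((k.1 : ℂ) - N) * ⟪b k, u⟫ + ⟪b k, X u⟫ = ⟪b k, f⟫

/-- The reduced resolvent of the diagonal operator at the eigenvalue `N`. -/
def redRes : H →L[ℂ] H :=
  diagCLM b (fun k => ((k.1 : ℂ) - N)⁻¹) 1 zero_le_one (by
    intro k
    by_cases h : k.1 = N
    -- On level `N` the entry is `0⁻¹ = 0`, which makes this the reduced resolvent; elsewhere the
    -- integer gap is at least 1.
    · simp [h]
    · rw [norm_inv]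
      apply inv_le_one_of_one_le₀
      have : ((k.1 : ℂ) - N) = (((k.1 : ℤ) - N : ℤ) : ℂ) := by push_cast; rfl
      rw [this, Complex.norm_intCast]
      exact_mod_cast Int.one_le_abs (sub_ne_zero.mpr (Nat.cast_injective.ne h)))

theorem norm_redRes_le : ‖redRes b N‖ ≤ 1 := norm_diagCLM_le ..

theorem inner_redRes (k : ℕ × ℤˣ) (u : H) :
    ⟪b k, redRes b N u⟫ = ((k.1 : ℂ) - N)⁻¹ * ⟪b k, u⟫ := inner_diagCLM ..

theorem inner_redRes_self (s : ℤˣ) (u : H) : ⟪b (N, s), redRes b N u⟫ = 0 := by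
  simp [inner_redRes]

theorem inner_basis (k l : ℕ × ℤˣ) : ⟪b k, b l⟫ = if k = l then 1 else 0 := by
  classical
  simpa using orthonormal_iff_ite.mp b.orthonormal k l

theorem inner_level_sum (k : ℕ × ℤˣ) (c : ℤˣ → ℂ) :
    ⟪b k, ∑ s, c s • b (N, s)⟫ = if k.1 = N then c k.2 else 0 := by
  simp only [inner_sum, inner_smul_right, inner_basis]
  obtain ⟨n, t⟩ := k
  by_cases h : n = N
  · subst h; simp [-UnitsInt.univ]
  · simp [h]

/-- Dividing by `n - N` solves the equation off level `N` and leaves the level-`N` coefficients of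
`u` free; the level-`N` components of the equation survive as the second condition. -/
theorem diagEq_iff (X : H →L[ℂ] H) (u f : H) :
    DiagEq b N X u f ↔
      u + redRes b N (X u) = ∑ s, ⟪b (N, s), u⟫ • b (N, s) + redRes b N f ∧
        ∀ s, ⟪b (N, s), X u⟫ = ⟪b (N, s), f⟫ := by
  constructor
  · intro h
    refine ⟨hilbertBasis_ext b fun k => ?_, fun s => by simpa using h (N, s)⟩
    rw [inner_add_right, inner_add_right, inner_level_sum, inner_redRes, inner_redRes, ← h k]
    obtain ⟨n, t⟩ := k
    by_cases hn : n = N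
    · subst hn; simp
    · have : (n : ℂ) - N ≠ 0 := sub_ne_zero.mpr (by exact_mod_cast hn)
      simp only [hn, if_false]
      field_simp
      ring
  · rintro ⟨h, h'⟩ ⟨n, t⟩
    by_cases hn : n = N
    · subst hn; simpa using h' t
    · have h2 := congrArg (fun v => ⟪b (n, t), v⟫) h
      have : (n : ℂ) - N ≠ 0 := sub_ne_zero.mpr (by exact_mod_cast hn)
      simp only [inner_add_right, inner_level_sum, inner_redRes, hn, if_false, zero_add] at h2 ⊢
      field_simp at h2
      rw [mul_comm, h2]

/-- The operator `(1 + S X)⁻¹`, where `S` is the reduced resolvent. -/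
def inv1 (X : H →L[ℂ] H) : H →L[ℂ] H := Ring.inverse (1 + redRes b N * X)

variable {b N}

section Unit

variable {X : H →L[ℂ] H} (hX : IsUnit (1 + redRes b N * X))
include hX

theorem inv1_add (u : H) : inv1 b N X u + redRes b N (X (inv1 b N X u)) = u := by
  have := congrArg (fun T : H →L[ℂ] H => T u) (Ring.mul_inverse_cancel _ hX)
  simpa [inv1, add_mul] using this

theorem inv1_apply (u : H) : inv1 b N X (u + redRes b N (X u)) = u := by
  have := congrArg (fun T : H →L[ℂ] H => T u) (Ring.inverse_mul_cancel _ hX)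
  simpa [inv1, mul_add] using this

/-- The range of the reduced resolvent is orthogonal to level `N`, so `(1 + S X)⁻¹` leaves the
level-`N` coefficients unchanged. -/
theorem inner_inv1 (s : ℤˣ) (u : H) : ⟪b (N, s), inv1 b N X u⟫ = ⟪b (N, s), u⟫ := by
  conv_rhs => rw [← inv1_add hX u]
  rw [inner_add_right, inner_redRes_self, add_zero]

theorem diagEq_iff_inv1 (u f : H) :
    DiagEq b N X u f ↔
      u = inv1 b N X (∑ s, ⟪b (N, s), u⟫ • b (N, s) + redRes b N f) ∧
        ∀ s, ⟪b (N, s), X u⟫ = ⟪b (N, s), f⟫ := by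
  rw [diagEq_iff]
  refine and_congr_left fun _ => ⟨fun h => ?_, fun h => ?_⟩
  · rw [← h, inv1_apply hX]
  · set w := ∑ s, ⟪b (N, s), u⟫ • b (N, s) + redRes b N f
    rw [h, inv1_add hX]

theorem diagEq_inv1_iff (c : ℤˣ → ℂ) (f : H) :
    DiagEq b N X (inv1 b N X (∑ s, c s • b (N, s) + redRes b N f)) f ↔
      ∀ s, ⟪b (N, s), X (inv1 b N X (∑ s, c s • b (N, s) + redRes b N f))⟫ = ⟪b (N, s), f⟫ := by
  rw [diagEq_iff_inv1 hX]
  refine and_iff_right ?_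
  congr 2
  refine Finset.sum_congr rfl fun s _ => ?_
  rw [inner_inv1 hX, inner_add_right, inner_redRes_self, inner_level_sum]
  simp

end Unit

variable (b N) in
/-- The function whose zeros detect the eigenvalues. -/
def secular (s : ℤˣ) (X : H →L[ℂ] H) : ℂ := ⟪b (N, s), X (inv1 b N X (b (N, s)))⟫

/-- The parity of the vector `b (n, s)`. -/
def parityOf (k : ℕ × ℤˣ) : ℤˣ := k.2 * (-1) ^ k.1

section Parity

variable {X P : H →L[ℂ] H} (hX : IsUnit (1 + redRes b N * X))
  (hP : ∀ k, P (b k) = ((parityOf k : ℤ) : ℂ) • b k) (hc : ∀ u, P (X u) = X (P u))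
include hP

theorem parity_redRes (u : H) : P (redRes b N u) = redRes b N (P u) := by
  refine hilbertBasis_ext b fun k => ?_
  simp only [inner_of_eigenbasis b P _ hP, inner_redRes]
  ring

theorem inner_eq_zero_of_parity {s t : ℤˣ} (hst : s ≠ t) {v : H}
    (hv : P v = ((parityOf (N, s) : ℤ) : ℂ) • v) : ⟪b (N, t), v⟫ = 0 := by
  have h := inner_of_eigenbasis b P _ hP (N, t) v
  rw [hv, inner_smul_right] at h
  have h2 : ((parityOf (N, s) : ℤ) : ℂ) ≠ ((parityOf (N, t) : ℤ) : ℂ) := by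
    intro h3
    apply hst
    have h4 : parityOf (N, s) = parityOf (N, t) := Units.ext (by exact_mod_cast h3)
    exact mul_right_cancel h4
  have h3 : (((parityOf (N, s) : ℤ) : ℂ) - ((parityOf (N, t) : ℤ) : ℂ)) * ⟪b (N, t), v⟫ = 0 := by
    linear_combination h
  exact (mul_eq_zero.mp h3).resolve_left (sub_ne_zero.mpr h2)

include hX hc

theorem parity_inv1 (u : H) : P (inv1 b N X u) = inv1 b N X (P u) := by
  have h := congrArg P (inv1_add hX u)
  rw [map_add, parity_redRes hP, hc] at h
  rw [← h, inv1_apply hX]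

theorem parity_inv1_basis (s : ℤˣ) :
    P (inv1 b N X (b (N, s))) = ((parityOf (N, s) : ℤ) : ℂ) • inv1 b N X (b (N, s)) := by
  rw [parity_inv1 hX hP hc, hP, map_smul]

/-- The effective 2×2 matrix on level `N` is diagonal: its off-diagonal entries pair vectors of
opposite parity. -/
theorem inner_secular_offdiag (c : ℤˣ → ℂ) (s : ℤˣ) :
    ⟪b (N, s), X (inv1 b N X (∑ t, c t • b (N, t)))⟫ = c s * secular b N s X := by
  simp only [map_sum, map_smul, inner_sum, inner_smul_right]
  rw [Finset.sum_eq_single s]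
  · rfl
  · intro t _ hts
    rw [inner_eq_zero_of_parity hP hts, mul_zero]
    rw [hc, parity_inv1_basis hX hP hc, map_smul]
  · exact fun h => absurd (Finset.mem_univ s) h

theorem diagEq_zero_iff (u : H) :
    DiagEq b N X u 0 ↔ u = ∑ s, ⟪b (N, s), u⟫ • inv1 b N X (b (N, s)) ∧
      ∀ s, ⟪b (N, s), u⟫ * secular b N s X = 0 := by
  rw [diagEq_iff_inv1 hX, map_zero, add_zero]
  simp only [inner_zero_right]
  constructor
  · rintro ⟨h, h'⟩
    refine ⟨?_, fun s => ?_⟩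
    · simpa only [map_sum, map_smul] using h
    · rw [← inner_secular_offdiag hX hP hc (fun t => ⟪b (N, t), u⟫), ← h, h']
  · rintro ⟨h, h'⟩
    have h2 : u = inv1 b N X (∑ s, ⟪b (N, s), u⟫ • b (N, s)) := by
      conv_lhs => rw [h]
      simp only [map_sum, map_smul]
    refine ⟨h2, fun s => ?_⟩
    rw [← h' s, ← inner_secular_offdiag hX hP hc (fun t => ⟪b (N, t), u⟫), ← h2]

theorem diagEq_inv1_basis {s : ℤˣ} (h : secular b N s X = 0) :
    DiagEq b N X (inv1 b N X (b (N, s))) 0 := by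
  have h2 : ∀ t, ⟪b (N, t), inv1 b N X (b (N, s))⟫ = if t = s then 1 else 0 := by
    intro t
    rw [inner_inv1 hX, inner_basis]
    simp
  rw [diagEq_zero_iff hX hP hc]
  simp only [h2]
  simp [h, -UnitsInt.univ]

theorem exists_resolvent_of_secular_ne_zero (h : ∀ s, secular b N s X ≠ 0) :
    ∃ R : H →L[ℂ] H, (∀ f, DiagEq b N X (R f) f) ∧ ∀ u, DiagEq b N X u 0 → u = 0 := by
  -- The coefficient `c s` solves the scalar equation `c s * secular s + ⟪b, X (1 + S X)⁻¹ S f⟫ =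
  -- ⟪b, f⟫` with `b = b (N, s)`.
  let c : ℤˣ → H →L[ℂ] ℂ := fun s => (secular b N s X)⁻¹ •
    (innerSL ℂ (b (N, s)) - (innerSL ℂ (b (N, s))) ∘L X ∘L inv1 b N X ∘L redRes b N)
  refine ⟨inv1 b N X ∘L (∑ s, (c s).smulRight (b (N, s)) + redRes b N), fun f => ?_, fun u hu => ?_⟩
  · have h1 : (inv1 b N X ∘L (∑ s, (c s).smulRight (b (N, s)) + redRes b N)) f
        = inv1 b N X (∑ s, c s f • b (N, s) + redRes b N f) := by
      simp
    rw [h1, diagEq_inv1_iff hX]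
    intro s
    rw [map_add, map_add, inner_add_right, inner_secular_offdiag hX hP hc (fun t => c t f)]
    have h3 := h s
    simp only [c, smul_apply, sub_apply,
      innerSL_apply_apply, ContinuousLinearMap.comp_apply, smul_eq_mul]
    field_simp
    ring
  · obtain ⟨h1, h2⟩ := (diagEq_zero_iff hX hP hc u).mp hu
    rw [h1]
    refine Finset.sum_eq_zero fun s _ => ?_
    rw [(mul_eq_zero.mp (h2 s)).resolve_right (h s), zero_smul]

end Parity

end Abstract

/-! ### Existence, uniqueness and analyticity of the roots of the scalar equations. -/

section Branch

variable {H : Type*} [NormedAddCommGroup H] [InnerProductSpace ℂ H]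

local notation "⟪" x ", " y "⟫" => inner ℂ x y

/-- The operator `ε W - ζ`. -/
def pert (W : H →L[ℂ] H) (p : ℝ × ℝ) : H →L[ℂ] H := (p.1 : ℂ) • W - (p.2 : ℂ) • 1

theorem pert_apply (W : H →L[ℂ] H) (p : ℝ × ℝ) (u : H) :
    pert W p u = (p.1 : ℂ) • W u - (p.2 : ℂ) • u := rfl

variable {b : HilbertBasis (ℕ × ℤˣ) ℂ H} {N : ℕ} {W : H →L[ℂ] H}

theorem norm_pert_apply_le (p : ℝ × ℝ) (u : H) :
    ‖pert W p u‖ ≤ (|p.1| * ‖W‖ + |p.2|) * ‖u‖ := by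
  rw [pert_apply, add_mul]
  refine (norm_sub_le _ _).trans ?_
  rw [norm_smul, norm_smul, Complex.norm_real, Complex.norm_real, Real.norm_eq_abs,
    Real.norm_eq_abs, mul_assoc]
  gcongr
  exact W.le_opNorm u

theorem isUnit_one_add [CompleteSpace H] {T : H →L[ℂ] H} (h : ‖T‖ < 1) : IsUnit (1 + T) := by
  have := isUnit_one_sub_of_norm_lt_one (x := -T) (by rwa [norm_neg])
  rwa [sub_neg_eq_add] at this

theorem norm_redRes_apply_le (u : H) : ‖redRes b N u‖ ≤ ‖u‖ := by
  simpa using (redRes b N).le_of_opNorm_le (norm_redRes_le b N) u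

theorem isUnit_pert [CompleteSpace H] {p : ℝ × ℝ} (h : |p.1| * ‖W‖ + |p.2| < 1) :
    IsUnit (1 + redRes b N * pert W p) := by
  apply isUnit_one_add
  refine lt_of_le_of_lt (ContinuousLinearMap.opNorm_le_bound _ (by positivity) fun u => ?_) h
  exact (norm_redRes_apply_le _).trans (norm_pert_apply_le p u)

theorem redRes_basis (k : ℕ × ℤˣ) : redRes b N (b k) = ((k.1 : ℂ) - N)⁻¹ • b k := by
  refine hilbertBasis_ext b fun l => ?_
  rw [inner_redRes, inner_smul_right, inner_basis]
  split_ifs with h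
  · rw [h]
  · simp

theorem redRes_symm [CompleteSpace H] (u v : H) : ⟪redRes b N u, v⟫ = ⟪u, redRes b N v⟫ := by
  have h : (redRes b N).adjoint v = redRes b N v := by
    refine hilbertBasis_ext b fun k => ?_
    rw [ContinuousLinearMap.adjoint_inner_right, redRes_basis, inner_smul_left, inner_redRes]
    simp
  rw [← ContinuousLinearMap.adjoint_inner_right, h]

theorem pert_symm (hW : ∀ u v, ⟪W u, v⟫ = ⟪u, W v⟫) (p : ℝ × ℝ) (u v : H) :
    ⟪pert W p u, v⟫ = ⟪u, pert W p v⟫ := by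
  simp only [pert_apply, inner_sub_left, inner_sub_right, inner_smul_left, inner_smul_right, hW,
    Complex.conj_ofReal]

/-- With `u = (1 + S X)⁻¹ b` the value is `⟪u, X u⟫ + ⟪S X u, X u⟫`, and both terms are real by
symmetry of `X` and `S`. Hence one real equation captures the complex one. -/
theorem secular_im [CompleteSpace H] {X : H →L[ℂ] H} (hX : IsUnit (1 + redRes b N * X))
    (hs : ∀ u v, ⟪X u, v⟫ = ⟪u, X v⟫) (s : ℤˣ) : (secular b N s X).im = 0 := by
  rw [← Complex.conj_eq_iff_im, secular, inner_conj_symm]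
  have h := inv1_add hX (b (N, s))
  generalize inv1 b N X (b (N, s)) = u at h ⊢
  rw [← h, inner_add_left, inner_add_right, hs, redRes_symm]

/-- The real part of the secular function as a function of `(ε, ζ)`. -/
def secularRe (b : HilbertBasis (ℕ × ℤˣ) ℂ H) (N : ℕ) (W : H →L[ℂ] H) (s : ℤˣ) (p : ℝ × ℝ) : ℝ :=
  (secular b N s (pert W p)).re

variable (W) in
/-- `pert W` as a continuous real-linear map. -/
def pertCLM : ℝ × ℝ →L[ℝ] H →L[ℂ] H :=
  (ContinuousLinearMap.fst ℝ ℝ ℝ).smulRight W - (ContinuousLinearMap.snd ℝ ℝ ℝ).smulRight 1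

theorem pertCLM_apply (p : ℝ × ℝ) : pertCLM W p = pert W p := by
  ext u
  simp [pertCLM, pert]

/-- `T ↦ Re (v, T v)`. -/
def quadForm (v : H) : (H →L[ℂ] H) →L[ℝ] ℝ :=
  Complex.reCLM ∘L ((innerSL ℂ v ∘L ContinuousLinearMap.apply ℂ H v).restrictScalars ℝ)

theorem quadForm_apply (v : H) (T : H →L[ℂ] H) : quadForm v T = (⟪v, T v⟫).re := rfl

theorem secularRe_eq (s : ℤˣ) : secularRe b N W s =
    fun p => quadForm (b (N, s)) (pertCLM W p * Ring.inverse (1 + redRes b N * pertCLM W p)) := by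
  funext p
  rw [quadForm_apply, pertCLM_apply]
  rfl

theorem analyticAt_inverse_pert [CompleteSpace H] :
    AnalyticAt ℝ (fun p => Ring.inverse (1 + redRes b N * pertCLM W p)) 0 := by
  have h1 : AnalyticAt ℝ (fun p : ℝ × ℝ => 1 + redRes b N * pertCLM W p) 0 :=
    analyticAt_const.add (analyticAt_const.mul ((pertCLM W).analyticAt 0))
  refine AnalyticAt.comp (g := Ring.inverse) ?_ h1
  simp only [map_zero, mul_zero, add_zero]
  exact analyticAt_inverse (1 : (H →L[ℂ] H)ˣ)

theorem analyticAt_secularRe [CompleteSpace H] (s : ℤˣ) : AnalyticAt ℝ (secularRe b N W s) 0 := by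
  rw [secularRe_eq]
  exact ((quadForm (b (N, s))).analyticAt _).comp
    (((pertCLM W).analyticAt 0).mul analyticAt_inverse_pert)

/-- The factor `pertCLM W` vanishes at the origin, so the derivative of the inverse drops out of the
product rule and only first-order perturbation theory remains. -/
theorem hasFDerivAt_secularRe [CompleteSpace H] (s : ℤˣ) :
    HasFDerivAt (secularRe b N W s) (quadForm (b (N, s)) ∘L pertCLM W) 0 := by
  rw [secularRe_eq]
  refine (quadForm (b (N, s))).hasFDerivAt.comp (0 : ℝ × ℝ) ?_
  have h := ((pertCLM W).hasFDerivAt (x := 0)).mul'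
    (analyticAt_inverse_pert (b := b) (N := N) (W := W)).differentiableAt.hasFDerivAt
  refine h.congr_fderiv ?_
  ext p
  all_goals simp

theorem secularRe_zero [CompleteSpace H] (s : ℤˣ) : secularRe b N W s 0 = 0 := by
  rw [secularRe_eq]; simp

/-- Since `⟪b, u⟫ = 1`, a root satisfies `z = ε ⟪b, W u⟫`. Thus `z₁ - z₂` is controlled by `u₁ - u₂`
with the small factor `1/10`, and feeding this back into the equation for `u₁ - u₂` gives a strict
contraction up to the ends of the window. -/
theorem eq_of_secular_eq_zero [CompleteSpace H] {ε z₁ z₂ : ℝ}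
    (hε : |ε| * ‖W‖ ≤ 1 / 10) (h₁ : |z₁| ≤ 1 / 2) (h₂ : |z₂| ≤ 1 / 2) {s : ℤˣ} (hz₁ : secular b N s (pert W (ε, z₁)) = 0)
    (hz₂ : secular b N s (pert W (ε, z₂)) = 0) : z₁ = z₂ := by
  have hU : ∀ z : ℝ, |z| ≤ 1 / 2 → IsUnit (1 + redRes b N * pert W (ε, z)) := fun z hz =>
    isUnit_pert (by simp only; linarith)
  set u₁ := inv1 b N (pert W (ε, z₁)) (b (N, s)) with hu₁
  set u₂ := inv1 b N (pert W (ε, z₂)) (b (N, s)) with hu₂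
  have e₁ : u₁ + redRes b N (pert W (ε, z₁) u₁) = b (N, s) := inv1_add (hU z₁ h₁) _
  have e₂ : u₂ + redRes b N (pert W (ε, z₂) u₂) = b (N, s) := inv1_add (hU z₂ h₂) _
  have i₁ : ⟪b (N, s), u₁⟫ = 1 := by rw [hu₁, inner_inv1 (hU z₁ h₁), inner_basis, if_pos rfl]
  have i₂ : ⟪b (N, s), u₂⟫ = 1 := by rw [hu₂, inner_inv1 (hU z₂ h₂), inner_basis, if_pos rfl]
  have j₁ : (ε : ℂ) * ⟪b (N, s), W u₁⟫ = z₁ := by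
    have : ⟪b (N, s), pert W (ε, z₁) u₁⟫ = 0 := hz₁
    rw [pert_apply, inner_sub_right, inner_smul_right, inner_smul_right, i₁] at this
    linear_combination this
  have j₂ : (ε : ℂ) * ⟪b (N, s), W u₂⟫ = z₂ := by
    have : ⟪b (N, s), pert W (ε, z₂) u₂⟫ = 0 := hz₂
    rw [pert_apply, inner_sub_right, inner_smul_right, inner_smul_right, i₂] at this
    linear_combination this
  have hb : ‖b (N, s)‖ = 1 := b.orthonormal.1 _
  have hεv : ∀ v, ‖(ε : ℂ) • W v‖ ≤ 1 / 10 * ‖v‖ := by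
    intro v
    rw [norm_smul, Complex.norm_real, Real.norm_eq_abs]
    calc |ε| * ‖W v‖ ≤ |ε| * (‖W‖ * ‖v‖) := by gcongr; exact W.le_opNorm v
      _ = (|ε| * ‖W‖) * ‖v‖ := by ring
      _ ≤ _ := by gcongr
  have hz : |z₁ - z₂| ≤ 1 / 10 * ‖u₁ - u₂‖ := by
    have : ((z₁ - z₂ : ℝ) : ℂ) = ⟪b (N, s), (ε : ℂ) • W (u₁ - u₂)⟫ := by
      rw [inner_smul_right, map_sub, inner_sub_right, mul_sub, j₁, j₂]; push_cast; rfl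
    rw [← Real.norm_eq_abs, ← Complex.norm_real, this]
    refine (norm_inner_le_norm _ _).trans ?_
    rw [hb, one_mul]
    exact hεv _
  -- This follows from `‖u₂‖ ≤ 1 + (1/10 + 1/2) ‖u₂‖`.
  have hn₂ : ‖u₂‖ ≤ 5 / 2 := by
    have h3 : u₂ = b (N, s) - redRes b N (pert W (ε, z₂) u₂) := eq_sub_of_add_eq e₂
    have h4 : ‖u₂‖ ≤ 1 + (|ε| * ‖W‖ + |z₂|) * ‖u₂‖ := by
      conv_lhs => rw [h3]
      refine (norm_sub_le _ _).trans ?_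
      rw [hb]
      gcongr
      exact (norm_redRes_apply_le _).trans (norm_pert_apply_le (ε, z₂) u₂)
    nlinarith [norm_nonneg u₂]
  have hv : ‖u₁ - u₂‖ ≤ 1 / 10 * ‖u₁ - u₂‖ + (1 / 2 * ‖u₁ - u₂‖ + |z₁ - z₂| * ‖u₂‖) := by
    have h3 : u₁ - u₂ = - redRes b N ((ε : ℂ) • W (u₁ - u₂)
        - ((z₁ : ℂ) • (u₁ - u₂) + ((z₁ - z₂ : ℝ) : ℂ) • u₂)) := by
      have h4 : u₁ - u₂ = - redRes b N (pert W (ε, z₁) u₁ - pert W (ε, z₂) u₂) := by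
        rw [map_sub]
        linear_combination (norm := module) e₁ - e₂
      conv_lhs => rw [h4]
      congr 2
      simp only [pert_apply, map_sub, Complex.ofReal_sub]
      module
    conv_lhs => rw [h3]
    rw [norm_neg]
    refine (norm_redRes_apply_le _).trans ((norm_sub_le _ _).trans ?_)
    refine add_le_add (hεv _) ((norm_add_le _ _).trans ?_)
    rw [norm_smul, norm_smul, Complex.norm_real, Complex.norm_real, Real.norm_eq_abs,
      Real.norm_eq_abs]
    gcongr
  -- The total factor is `1/10 + 1/2 + (1/10)(5/2) = 17/20 < 1`.
  have hv0 : ‖u₁ - u₂‖ = 0 := by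
    have : |z₁ - z₂| * ‖u₂‖ ≤ (1 / 10 * ‖u₁ - u₂‖) * (5 / 2) := by gcongr
    nlinarith [norm_nonneg (u₁ - u₂)]
  rw [hv0, mul_zero] at hz
  exact sub_eq_zero.mp (abs_eq_zero.mp (le_antisymm hz (abs_nonneg _)))

theorem exists_branch [CompleteSpace H] (hW : ∀ u v, ⟪W u, v⟫ = ⟪u, W v⟫) (s : ℤˣ) :
    ∃ δ : ℝ, 0 < δ ∧ ∃ ζ : ℝ → ℝ, AnalyticOnNhd ℝ ζ (Ioo (-δ) δ) ∧ ζ 0 = 0 ∧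
      HasDerivAt ζ (⟪b (N, s), W (b (N, s))⟫).re 0 ∧
      ∀ ε : ℝ, |ε| < δ → |ε| * ‖W‖ ≤ 1 / 10 ∧ |ζ ε| < 1 / 2 ∧
        ∀ z : ℝ, |z| ≤ 1 / 2 → (secular b N s (pert W (ε, z)) = 0 ↔ z = ζ ε) := by
  set f := secularRe b N W s
  have cdf : ContDiffAt ℝ ⊤ f (0 : ℝ × ℝ) := (analyticAt_secularRe s).contDiffAt
  have hfd : fderiv ℝ f (0 : ℝ × ℝ) = quadForm (b (N, s)) ∘L pertCLM W :=
    (hasFDerivAt_secularRe s).fderiv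
  -- The partial derivative in `ζ` is `-‖b (N, s)‖² = -1`, hence invertible.
  have hr : fderiv ℝ f (0 : ℝ × ℝ) ∘L ContinuousLinearMap.inr ℝ ℝ ℝ
      = ((ContinuousLinearEquiv.neg ℝ : ℝ ≃L[ℝ] ℝ) : ℝ →L[ℝ] ℝ) := by
    ext
    simp [hfd, quadForm_apply, pertCLM, -inner_self_eq_norm_sq_to_K, inner_basis]
  have hinv : (fderiv ℝ f (0 : ℝ × ℝ) ∘L ContinuousLinearMap.inr ℝ ℝ ℝ).IsInvertible :=
    ⟨_, hr.symm⟩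
  set ζ := cdf.implicitFunction (by simp) hinv with hζ
  have h0 : ζ 0 = 0 := cdf.implicitFunction_apply_self (by simp) hinv
  have hA : AnalyticAt ℝ ζ 0 := (cdf.contDiffAt_implicitFunction (by simp) hinv).analyticAt
  have hF : ∀ᶠ ε in nhds (0 : ℝ), f (ε, ζ ε) = 0 := by
    have := cdf.eventually_apply_implicitFunction (by simp) hinv
    rwa [show f (0 : ℝ × ℝ) = 0 from secularRe_zero s] at this
  have hD : HasDerivAt ζ (⟪b (N, s), W (b (N, s))⟫).re 0 := by
    have h := (cdf.hasStrictFDerivAt_implicitFunction (by simp) hinv).hasFDerivAt.hasDerivAt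
    rw [hr, hfd, ContinuousLinearMap.inverse_equiv] at h
    refine h.congr_deriv ?_
    simp [quadForm_apply, pertCLM]
  have hsmall : ∀ᶠ ε in nhds (0 : ℝ), |ζ ε| < 1 / 2 := by
    have : Filter.Tendsto (fun ε => |ζ ε|) (nhds 0) (nhds |ζ 0|) := hA.continuousAt.abs
    rw [h0, abs_zero] at this
    exact this.eventually_lt_const (by norm_num)
  have hsmall2 : ∀ᶠ ε in nhds (0 : ℝ), |ε| * ‖W‖ < 1 / 10 := by
    have : Filter.Tendsto (fun ε : ℝ => |ε| * ‖W‖) (nhds 0) (nhds (|0| * ‖W‖)) :=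
      (continuous_abs.mul continuous_const).tendsto 0
    rw [abs_zero, zero_mul] at this
    exact this.eventually_lt_const (by norm_num)
  obtain ⟨δ, hδ, hb⟩ := Metric.eventually_nhds_iff.mp
    (hA.eventually_analyticAt.and (hF.and (hsmall.and hsmall2)))
  refine ⟨δ, hδ, ζ, fun ε hε => (hb ?_).1, h0, hD, fun ε hε => ?_⟩
  · rw [Real.dist_eq, sub_zero, abs_lt]; exact hε
  · obtain ⟨-, h1, h2, h3⟩ := hb (show dist ε 0 < δ by rwa [Real.dist_eq, sub_zero])
    refine ⟨h3.le, h2, fun z hz => ?_⟩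
    have hroot : secular b N s (pert W (ε, ζ ε)) = 0 := by
      refine Complex.ext h1 (secular_im (isUnit_pert (by simp only; linarith)) (pert_symm hW _) s)
    constructor
    · intro h
      exact eq_of_secular_eq_zero h3.le hz h2.le h hroot
    · rintro rfl
      exact hroot

end Branch

/-! ### Hermite functions: ladder relations, oscillator equation, orthogonality and reflection. -/

section Hermite

theorem exists_bound_pow_mul_gaussian (m : ℕ) :
    ∃ C, ∀ x : ℝ, |x ^ m| * Real.exp (-(x ^ 2 / 2)) ≤ C := by
  refine ⟨1 + 2 ^ m * m.factorial, fun x => ?_⟩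
  have h1 := Real.pow_div_factorial_le_exp (x ^ 2 / 2) (by positivity) m
  have h2 : |x ^ m| ≤ 1 + x ^ (2 * m) := by
    have : x ^ (2 * m) = |x ^ m| ^ 2 := by rw [sq_abs]; ring
    rw [this]
    nlinarith [sq_nonneg (|x ^ m| - 1)]
  have h3 : x ^ (2 * m) ≤ 2 ^ m * m.factorial * Real.exp (x ^ 2 / 2) := by
    have h4 : x ^ (2 * m) = 2 ^ m * m.factorial * ((x ^ 2 / 2) ^ m / m.factorial) := by
      have : (m.factorial : ℝ) ≠ 0 := by positivity
      rw [pow_mul, div_pow]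
      field_simp
    rw [h4]
    gcongr
  have h5 : 1 ≤ Real.exp (x ^ 2 / 2) := Real.one_le_exp (by positivity)
  calc |x ^ m| * Real.exp (-(x ^ 2 / 2))
      ≤ ((1 + 2 ^ m * m.factorial) * Real.exp (x ^ 2 / 2)) * Real.exp (-(x ^ 2 / 2)) := by
        gcongr
        linarith
    _ = _ := by rw [mul_assoc, ← Real.exp_add]; simp

theorem exists_bound_aeval_mul_gaussian (p : Polynomial ℤ) :
    ∃ C, ∀ x : ℝ, |Polynomial.aeval x p| * Real.exp (-(x ^ 2 / 2)) ≤ C := by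
  induction p using Polynomial.induction_on' with
  | add p q hp hq =>
    obtain ⟨C, hC⟩ := hp
    obtain ⟨D, hD⟩ := hq
    refine ⟨C + D, fun x => ?_⟩
    rw [map_add]
    have := mul_le_mul_of_nonneg_right (abs_add_le (Polynomial.aeval x p) (Polynomial.aeval x q))
      (Real.exp_pos (-(x ^ 2 / 2))).le
    linarith [hC x, hD x]
  | monomial n a =>
    obtain ⟨C, hC⟩ := exists_bound_pow_mul_gaussian n
    refine ⟨|(a : ℝ)| * C, fun x => ?_⟩
    rw [Polynomial.aeval_monomial, abs_mul, mul_assoc]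
    exact mul_le_mul_of_nonneg_left (hC x) (abs_nonneg _)

/-- The Gaussian `e^{-x²/2}` as a Schwartz function. -/
def gaussianSchwartz : 𝓢(ℝ, ℝ) where
  toFun := fun x => Real.exp (-(x ^ 2 / 2))
  smooth' := by fun_prop
  decay' := by
    intro k n
    -- The `n`-th derivative of the Gaussian is, up to sign, a Hermite polynomial times the
    -- Gaussian.
    obtain ⟨C, hC⟩ := exists_bound_aeval_mul_gaussian (Polynomial.X ^ k * Polynomial.hermite n)
    refine ⟨C, fun x => le_trans (le_of_eq ?_) (hC x)⟩
    rw [norm_iteratedFDeriv_eq_norm_iteratedDeriv, iteratedDeriv_eq_iterate,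
      Polynomial.deriv_gaussian_eq_hermite_mul_gaussian]
    simp [abs_mul, mul_assoc]

/-- Multiplication by `x` on Schwartz functions. -/
def mulX : 𝓢(ℝ, ℝ) →L[ℝ] 𝓢(ℝ, ℝ) := SchwartzMap.smulLeftCLM ℝ (fun x : ℝ => x)

theorem mulX_apply (f : 𝓢(ℝ, ℝ)) (x : ℝ) : mulX f x = x * f x := by
  rw [mulX, SchwartzMap.smulLeftCLM_apply_apply (by fun_prop), smul_eq_mul]

/-- The Hermite functions as Schwartz functions. -/
def herm : ℕ → 𝓢(ℝ, ℝ)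
  | 0 => gaussianSchwartz
  | N + 1 => (√2)⁻¹ • (mulX (herm N) - SchwartzMap.derivCLM ℝ ℝ (herm N))

theorem coe_herm (N : ℕ) : (herm N : ℝ → ℝ) = hermiteFun N := by
  induction N with
  | zero =>
    funext x
    show Real.exp (-(x ^ 2 / 2)) = Real.exp (-x ^ 2 / 2)
    rw [neg_div]
  | succ N ih =>
    funext x
    simp only [herm, hermiteFun, smul_apply, sub_apply, mulX_apply, SchwartzMap.derivCLM_apply, ih,
      smul_eq_mul]
    ring

theorem herm_succ_apply (N : ℕ) (x : ℝ) :
    herm (N + 1) x = (√2)⁻¹ * (x * herm N x - deriv (herm N) x) := by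
  simp [herm, mulX_apply]

theorem deriv_mulX (f : 𝓢(ℝ, ℝ)) (x : ℝ) : deriv (mulX f) x = f x + x * deriv f x := by
  have h : (mulX f : ℝ → ℝ) = fun x => x * f x := funext (mulX_apply f)
  rw [h]
  have := (hasDerivAt_id' x).fun_mul (f.hasDerivAt x)
  simpa using this.deriv

/-- The annihilation operator lowers the degree; the value at `0` is immaterial. -/
theorem lowering (N : ℕ) :
    mulX (herm N) + SchwartzMap.derivCLM ℝ ℝ (herm N) = (√2 * N) • herm (N - 1) := by
  induction N with
  | zero =>
    ext x
    have h : HasDerivAt (fun x : ℝ => Real.exp (-(x ^ 2 / 2)))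
        (Real.exp (-(x ^ 2 / 2)) * (-(2 * x / 2))) x := by
      have h1 : HasDerivAt (fun x : ℝ => -(x ^ 2 / 2)) (-(2 * x / 2)) x := by
        simpa using ((hasDerivAt_pow 2 x).div_const 2).fun_neg
      exact h1.exp
    have h2 : deriv (herm 0) x = Real.exp (-(x ^ 2 / 2)) * (-(2 * x / 2)) := h.deriv
    have h3 : herm 0 x = Real.exp (-(x ^ 2 / 2)) := rfl
    simp only [add_apply, mulX_apply, SchwartzMap.derivCLM_apply, h2, h3, smul_apply]
    simp
    ring
  | succ N ih =>
    have h2 : √2 ≠ 0 := by positivity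
    have h22 : √2 * √2 = 2 := Real.mul_self_sqrt (by norm_num)
    set D : 𝓢(ℝ, ℝ) →L[ℝ] 𝓢(ℝ, ℝ) := SchwartzMap.derivCLM ℝ ℝ with hD
    have comm : ∀ f, D (mulX f) = f + mulX (D f) := by
      intro f; ext x
      simp only [hD, SchwartzMap.derivCLM_apply, add_apply, mulX_apply, deriv_mulX]
    have hs : herm (N + 1) = (√2)⁻¹ • (mulX (herm N) - D (herm N)) := rfl
    have h3 : mulX (herm (N + 1)) + D (herm (N + 1)) =
        (√2)⁻¹ • (mulX (mulX (herm N) + D (herm N)) - D (mulX (herm N) + D (herm N))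
          + (2 : ℝ) • herm N) := by
      rw [hs]
      simp only [map_smul, map_sub, map_add, comm]
      module
    rw [h3, ih]
    rcases N with _ | M
    · simp only [Nat.cast_zero, mul_zero, zero_smul, map_zero, sub_zero, zero_add, smul_smul]
      congr 1
      simp
      field_simp
      rw [sq, h22]
    · have hs' : mulX (herm M) - D (herm M) = √2 • herm (M + 1) := by
        show _ = √2 • ((√2)⁻¹ • (mulX (herm M) - D (herm M)))
        rw [smul_smul, mul_inv_cancel₀ h2, one_smul]
      simp only [Nat.add_sub_cancel, map_smul, ← smul_sub, hs', smul_smul, ← add_smul]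
      congr 1
      push_cast
      field_simp
      linear_combination ((M : ℝ) + 1 - (M + 1 + 1)) * h22

theorem herm_lower (N : ℕ) (x : ℝ) :
    x * herm N x + deriv (herm N) x = √2 * N * herm (N - 1) x := by
  have := congrArg (fun f : 𝓢(ℝ, ℝ) => f x) (lowering N)
  simpa [mulX_apply] using this

theorem herm_raise (N : ℕ) (x : ℝ) :
    x * herm N x - deriv (herm N) x = √2 * herm (N + 1) x := by
  have h2 : √2 ≠ 0 := by positivity
  rw [herm_succ_apply]
  field_simp

theorem herm_mul_self (N : ℕ) (x : ℝ) :
    x * herm N x = (√2)⁻¹ * (herm (N + 1) x + N * herm (N - 1) x) := by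
  have h2 : √2 ≠ 0 := by positivity
  have h22 : √2 * √2 = 2 := Real.mul_self_sqrt (by norm_num)
  field_simp
  apply mul_left_cancel₀ h2
  linear_combination x * herm N x * h22 + herm_lower N x + herm_raise N x

theorem herm_hamiltonian (N : ℕ) (x : ℝ) :
    x ^ 2 * herm N x - deriv (deriv (herm N)) x = (2 * N + 1) * herm N x := by
  have h22 : √2 * √2 = 2 := Real.mul_self_sqrt (by norm_num)
  have h1 : (fun x => deriv (herm N) x) = fun x => √2 * N * herm (N - 1) x - x * herm N x := by
    funext y; linear_combination herm_lower N y
  have h3 : deriv (deriv (herm N)) x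
      = √2 * N * deriv (herm (N - 1)) x - (herm N x + x * deriv (herm N) x) := by
    have e : deriv (herm N) = fun x => √2 * N * herm (N - 1) x - x * herm N x := h1
    rw [e]
    have hd := (((herm (N - 1)).hasDerivAt x).const_mul (√2 * N)).fun_sub
      ((hasDerivAt_id' x).fun_mul ((herm N).hasDerivAt x))
    rw [e] at hd
    simpa using hd.deriv
  rw [h3]
  have h4 : √2 * N * (x * herm (N - 1) x - deriv (herm (N - 1)) x) = 2 * N * herm N x := by
    rcases N with _ | M
    · simp
    · rw [Nat.add_sub_cancel, herm_raise]
      linear_combination ((M + 1 : ℕ) : ℝ) * herm (M + 1) x * h22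
  linear_combination h4 + x * herm_lower N x

theorem integrable_herm_mul (f g : 𝓢(ℝ, ℝ)) : Integrable (fun x => f x * g x) :=
  (f.memLp 2).integrable_mul (g.memLp 2)

/-- Integration by parts makes `x + ∂` the adjoint of `x - ∂`; orthogonality and positivity of the
norms then follow by induction on the degree. -/
theorem integral_raise_mul (f g : 𝓢(ℝ, ℝ)) :
    ∫ x, (x * f x - deriv f x) * g x = ∫ x, f x * (x * g x + deriv g x) := by
  have h := SchwartzMap.integral_mul_deriv_eq_neg_deriv_mul f g
  have i1 := integrable_herm_mul (mulX f) g
  have i2 := integrable_herm_mul (SchwartzMap.derivCLM ℝ ℝ f) g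
  have i3 := integrable_herm_mul f (SchwartzMap.derivCLM ℝ ℝ g)
  simp only [mulX_apply, SchwartzMap.derivCLM_apply] at i1 i2 i3
  have e1 : ∀ x, (x * f x - deriv f x) * g x = x * f x * g x - deriv f x * g x := fun x => by ring
  have e2 : ∀ x, f x * (x * g x + deriv g x) = x * f x * g x + f x * deriv g x := fun x => by ring
  simp only [e1, e2]
  rw [integral_sub i1 i2, integral_add i1 i3, h]
  ring

theorem integral_herm_succ_mul (N : ℕ) (g : 𝓢(ℝ, ℝ)) :
    √2 * ∫ x, herm (N + 1) x * g x = ∫ x, herm N x * (x * g x + deriv g x) := by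
  rw [← integral_raise_mul, ← integral_const_mul]
  congr 1; funext x
  rw [herm_raise, mul_assoc]

theorem integral_herm_succ_succ (N M : ℕ) :
    ∫ x, herm (N + 1) x * herm (M + 1) x = (M + 1) * ∫ x, herm N x * herm M x := by
  have h2 : √2 ≠ 0 := by positivity
  apply mul_left_cancel₀ h2
  rw [integral_herm_succ_mul, ← integral_const_mul, ← integral_const_mul]
  congr 1; funext x
  rw [herm_lower]; push_cast [Nat.add_sub_cancel]; ring

theorem integral_herm_succ_zero (N : ℕ) : ∫ x, herm (N + 1) x * herm 0 x = 0 := by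
  have h2 : √2 ≠ 0 := by positivity
  apply mul_left_cancel₀ h2
  rw [integral_herm_succ_mul]
  simp [herm_lower]

theorem integral_herm_mul_herm {N M : ℕ} (h : N ≠ M) : ∫ x, herm N x * herm M x = 0 := by
  induction N generalizing M with
  | zero =>
    obtain ⟨M, rfl⟩ := Nat.exists_eq_succ_of_ne_zero h.symm
    exact (integral_congr_ae (.of_forall fun x => mul_comm _ _)).trans (integral_herm_succ_zero M)
  | succ N ih =>
    rcases M with _ | M
    · exact integral_herm_succ_zero N
    · rw [integral_herm_succ_succ, ih (by omega), mul_zero]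

theorem integral_herm_sq_pos (N : ℕ) : 0 < ∫ x, herm N x * herm N x := by
  induction N with
  | zero =>
    have h : ∀ x : ℝ, herm 0 x * herm 0 x = Real.exp (-1 * x ^ 2) := by
      intro x
      show Real.exp (-(x ^ 2 / 2)) * Real.exp (-(x ^ 2 / 2)) = _
      rw [← Real.exp_add]; congr 1; ring
    simp only [h, integral_gaussian]
    positivity
  | succ N ih =>
    rw [integral_herm_succ_succ]
    positivity

theorem hermiteNormSq_eq (N : ℕ) : hermiteNormSq N = ∫ x, herm N x * herm N x := by
  simp only [hermiteNormSq, coe_herm, sq]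

theorem hermiteNormSq_pos (N : ℕ) : 0 < hermiteNormSq N := by
  rw [hermiteNormSq_eq]; exact integral_herm_sq_pos N

theorem herm_neg (N : ℕ) (x : ℝ) : herm N (-x) = (-1) ^ N * herm N x := by
  induction N generalizing x with
  | zero => show Real.exp _ = _ * Real.exp _; simp
  | succ N ih =>
    have hd : deriv (herm N) (-x) = -((-1) ^ N * deriv (herm N) x) := by
      have h1 : deriv (fun y => herm N (-y)) x = -deriv (herm N) (-x) := deriv_comp_neg _ x
      have h2 : (fun y => herm N (-y)) = fun y => (-1) ^ N * herm N y := funext ih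
      rw [h2, deriv_const_mul _ ((herm N).hasDerivAt x).differentiableAt] at h1
      linarith
    rw [herm_succ_apply, herm_succ_apply, ih, hd]
    ring

end Hermite

/-! ### Completeness of the Hermite functions through the Fourier transform. -/

section Completeness

open scoped FourierTransform

variable {g : ℝ → ℂ}

theorem integrable_schwartz_mul (f : 𝓢(ℝ, ℝ)) (hg : MemLp g 2) :
    Integrable (fun x => (f x : ℂ) * g x) :=
  ((f.memLp 2).ofReal (K := ℂ)).integrable_mul hg

/-- The three-term recurrence trades each power of `x` for neighbouring Hermite functions, so all
moments of `φ_N g` vanish. -/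
theorem integral_pow_mul_herm (hg : MemLp g 2) (h : ∀ N, ∫ x, (herm N x : ℂ) * g x = 0) (k N : ℕ) :
    ∫ x : ℝ, (x : ℂ) ^ k * ((herm N x : ℂ) * g x) = 0 := by
  induction k generalizing N with
  | zero => simpa using h N
  | succ k ih =>
    have hi : ∀ k N, Integrable (fun x : ℝ => (x : ℂ) ^ k * ((herm N x : ℂ) * g x)) := by
      intro k N
      have h1 : ∀ x : ℝ, ((mulX^[k] (herm N) x : ℝ) : ℂ) = (x : ℂ) ^ k * (herm N x : ℂ) := by
        intro x
        have : mulX^[k] (herm N) x = x ^ k * herm N x := by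
          induction k with
          | zero => simp
          | succ k ih => rw [Function.iterate_succ_apply', mulX_apply, ih]; ring
        rw [this]; push_cast; ring
      have := integrable_schwartz_mul (mulX^[k] (herm N)) hg
      simp only [h1] at this
      simpa only [mul_assoc] using this
    have e : ∀ x : ℝ, (x : ℂ) ^ (k + 1) * ((herm N x : ℂ) * g x)
        = ((√2)⁻¹ : ℝ) * ((x : ℂ) ^ k * ((herm (N + 1) x : ℂ) * g x)
          + N * ((x : ℂ) ^ k * ((herm (N - 1) x : ℂ) * g x))) := by
      intro x
      have := congrArg (fun t : ℝ => (t : ℂ)) (herm_mul_self N x)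
      push_cast at this ⊢
      rw [pow_succ]
      linear_combination (x : ℂ) ^ k * g x * this
    simp only [e]
    rw [integral_const_mul, integral_add (hi k _) ((hi k _).const_mul _), integral_const_mul,
      ih, ih]
    simp

theorem memLp_exp_mul_gaussian (c : ℝ) :
    MemLp (fun x : ℝ => Real.exp (c * |x|) * herm 0 x) 2 := by
  have hm : MemLp (fun x : ℝ => Real.exp (c ^ 2) * Real.exp (-(1 / 4) * x ^ 2)) 2 := by
    refine MemLp.const_mul ?_ _
    rw [memLp_two_iff_integrable_sq (by fun_prop)]
    have : (fun x : ℝ => Real.exp (-(1 / 4) * x ^ 2) ^ 2) =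
        fun x => Real.exp (-(1 / 2) * x ^ 2) := by
      funext x; rw [← Real.exp_nat_mul]; congr 1; push_cast; ring
    rw [this]
    exact integrable_exp_neg_mul_sq (by norm_num)
  refine hm.of_le (by fun_prop) (.of_forall fun x => ?_)
  have h0 : herm 0 x = Real.exp (-(x ^ 2 / 2)) := rfl
  rw [h0, ← Real.exp_add, ← Real.exp_add, Real.norm_of_nonneg (Real.exp_pos _).le,
    Real.norm_of_nonneg (Real.exp_pos _).le]
  apply Real.exp_le_exp.mpr
  -- The square gives `c |x| - x²/2 ≤ c² - x²/4`.
  nlinarith [sq_nonneg (|x| / 2 - c), sq_abs x]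

theorem integrable_exp_mul_gaussian_mul (hg : MemLp g 2) (c : ℝ) :
    Integrable (fun x : ℝ => Real.exp (c * |x|) * ‖(herm 0 x : ℂ) * g x‖) := by
  have h := (memLp_exp_mul_gaussian c).norm.integrable_mul hg.norm
  refine h.congr (.of_forall fun x => ?_)
  simp only [Pi.mul_apply, norm_mul, Complex.norm_real, Real.norm_eq_abs, Real.abs_exp]
  ring

/-- The exponential is expanded in its power series and integrated term by term: every term is a
vanishing moment, and the series is dominated by `exp (|2πt| |x|) ‖φ₀ g‖`, which is integrable. -/
theorem fourier_gaussian_mul (hg : MemLp g 2) (h : ∀ N, ∫ x, (herm N x : ℂ) * g x = 0) (t : ℝ) :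
    𝓕 (fun x : ℝ => (herm 0 x : ℂ) * g x) t = 0 := by
  rw [Real.fourier_eq']
  set f : ℝ → ℂ := fun x => (herm 0 x : ℂ) * g x
  have hf : Integrable f := integrable_schwartz_mul (herm 0) hg
  have key := hasSum_integral_of_dominated_convergence (μ := volume)
    (F := fun (k : ℕ) (x : ℝ) => ((-2 * Real.pi * t * x : ℝ) * Complex.I) ^ k / k.factorial * f x)
    (f := fun x : ℝ => Complex.exp ((-2 * Real.pi * t * x : ℝ) * Complex.I) * f x)
    (fun k x => (|2 * Real.pi * t| * |x|) ^ k / k.factorial * ‖f x‖) ?_ ?_ ?_ ?_ ?_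
  · have hz : ∀ k : ℕ, ∫ x : ℝ, ((-2 * Real.pi * t * x : ℝ) * Complex.I) ^ k / k.factorial * f x
        = 0 := by
      intro k
      have e : ∀ x : ℝ, ((-2 * Real.pi * t * x : ℝ) * Complex.I) ^ k / k.factorial * f x
          = ((-2 * Real.pi * t : ℝ) * Complex.I) ^ k / k.factorial *
            ((x : ℂ) ^ k * ((herm 0 x : ℂ) * g x)) := by
        intro x; simp only [f]; push_cast; ring
      simp only [e]
      rw [integral_const_mul, integral_pow_mul_herm hg h, mul_zero]
    simp only [hz] at key
    have h0 := key.unique hasSum_zero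
    rw [← h0]
    congr 1
    funext x
    rw [smul_eq_mul]
    congr 3
    simp
    ring
  · intro k
    refine AEStronglyMeasurable.mul ?_ hf.aestronglyMeasurable
    exact Continuous.aestronglyMeasurable (by fun_prop)
  · intro k
    refine .of_forall fun x => le_of_eq ?_
    simp [abs_mul, mul_pow, div_eq_mul_inv]
  · refine .of_forall fun x => ?_
    exact (Real.summable_pow_div_factorial _).mul_right _
  · have e : ∀ x : ℝ, ∑' k : ℕ, (|2 * Real.pi * t| * |x|) ^ k / k.factorial * ‖f x‖
        = Real.exp (|2 * Real.pi * t| * |x|) * ‖f x‖ := by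
      intro x
      rw [tsum_mul_right, Real.exp_eq_exp_ℝ, NormedSpace.exp_eq_tsum_div]
    simp only [e]
    exact integrable_exp_mul_gaussian_mul hg _
  · refine .of_forall fun x => ?_
    refine HasSum.mul_right _ ?_
    rw [Complex.exp_eq_exp_ℂ]
    exact NormedSpace.expSeries_div_hasSum_exp _

/-- The Hermite functions are complete in `L²`. -/
theorem ae_eq_zero_of_integral_herm (hg : MemLp g 2) (h : ∀ N, ∫ x, (herm N x : ℂ) * g x = 0) :
    g =ᵐ[volume] 0 := by
  have hf : Integrable (fun x : ℝ => (herm 0 x : ℂ) * g x) := integrable_schwartz_mul (herm 0) hg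
  have hF : 𝓕 (fun x : ℝ => (herm 0 x : ℂ) * g x) = 0 := funext (fourier_gaussian_mul hg h)
  have h1 : ∀ᵐ x : ℝ, (herm 0 x : ℂ) * g x = 0 := by
    refine ae_eq_zero_of_integral_contDiff_smul_eq_zero hf.locallyIntegrable fun φ hφ hc => ?_
    have hg₁ : HasCompactSupport (Complex.ofRealCLM ∘ φ) := hc.comp_left rfl
    have hg₂ : ContDiff ℝ (⊤ : ℕ∞) (Complex.ofRealCLM ∘ φ) := by fun_prop
    set ψ : 𝓢(ℝ, ℂ) := hg₁.toSchwartzMap hg₂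
    -- The multiplication formula moves the Fourier transform from `𝓕⁻ ψ` to `φ₀ g`, so a function
    -- with zero transform annihilates every test function.
    have key := VectorFourier.integral_bilin_fourierIntegral_eq_flip
      (ContinuousLinearMap.mul ℂ ℂ) (L := innerₗ ℝ) (μ := volume) (ν := volume)
      (e := Real.fourierChar) Real.continuous_fourierChar continuous_inner
      (𝓕⁻ ψ : 𝓢(ℝ, ℂ)).integrable hf
    have hψ : ∀ x, VectorFourier.fourierIntegral Real.fourierChar volume (innerₗ ℝ)
        ((𝓕⁻ ψ : 𝓢(ℝ, ℂ)) : ℝ → ℂ) x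
        = (φ x : ℂ) := by
      intro x
      have h3 : 𝓕 (𝓕⁻ ψ) = ψ := FourierTransform.fourier_fourierInv_eq ψ
      have h4 := congrArg (fun q : 𝓢(ℝ, ℂ) => q x) h3
      simp only [SchwartzMap.fourier_coe] at h4
      exact h4
    have hz : VectorFourier.fourierIntegral Real.fourierChar volume (innerₗ ℝ).flip
        (fun x : ℝ => (herm 0 x : ℂ) * g x) = 0 := by
      rw [flip_innerₗ]; exact hF
    simp only [hψ, hz] at key
    simpa using key
  filter_upwards [h1] with x hx
  have h0 : (herm 0 x : ℂ) ≠ 0 := by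
    have : herm 0 x = Real.exp (-(x ^ 2 / 2)) := rfl
    rw [this]; exact_mod_cast (Real.exp_pos _).ne'
  exact (mul_eq_zero.mp hx).resolve_left h0

end Completeness

/-! ### The orthonormal eigenbasis of the unperturbed operator. -/

section Basis

/-- The `ℂ²`-valued Schwartz function with real components `f`, `g`. -/
def vec (f g : 𝓢(ℝ, ℝ)) : 𝓢(ℝ, C2) :=
  SchwartzMap.postcompCLM (𝕜 := ℝ)
      (ContinuousLinearMap.toSpanSingleton ℝ (EuclideanSpace.single 0 (1 : ℂ))) f
    + SchwartzMap.postcompCLM (𝕜 := ℝ)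
      (ContinuousLinearMap.toSpanSingleton ℝ (EuclideanSpace.single 1 (1 : ℂ))) g

theorem vec_apply_zero (f g : 𝓢(ℝ, ℝ)) (x : ℝ) : vec f g x 0 = f x := by
  simp [vec]

theorem vec_apply_one (f g : 𝓢(ℝ, ℝ)) (x : ℝ) : vec f g x 1 = g x := by
  simp [vec]

/-- The complexification of a real Schwartz function. -/
def complexify : 𝓢(ℝ, ℝ) →L[ℝ] 𝓢(ℝ, ℂ) := SchwartzMap.postcompCLM Complex.ofRealCLM

theorem complexify_apply (f : 𝓢(ℝ, ℝ)) (x : ℝ) : complexify f x = f x := rfl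

/-- The components of an `L²` function as a tempered distribution. -/
def pairing (u : L2) (φ : 𝓢(ℝ, ℂ)) (i : Fin 2) : ℂ := (u : 𝓢'(ℝ, C2)) φ i

theorem memLp_component (u : L2) (i : Fin 2) : MemLp (fun x => u x i) 2 :=
  (Lp.memLp u).continuousLinearMap_comp (EuclideanSpace.proj (𝕜 := ℂ) i)

theorem integrable_smul_L2 (u : L2) (φ : 𝓢(ℝ, ℂ)) : Integrable (fun x => φ x • u x) :=
  memLp_one_iff_integrable.mp ((Lp.memLp u).smul (φ.memLp 2))

theorem pairing_eq (u : L2) (φ : 𝓢(ℝ, ℂ)) (i : Fin 2) : pairing u φ i = ∫ x, φ x * u x i := by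
  have h : (u : 𝓢'(ℝ, C2)) φ = ∫ x, φ x • u x := Lp.toTemperedDistribution_apply u φ
  have h2 := (EuclideanSpace.proj (𝕜 := ℂ) i : C2 →L[ℂ] ℂ).integral_comp_comm
    (integrable_smul_L2 u φ)
  rw [pairing, h]
  simpa using h2.symm

theorem inner_vec (f g : 𝓢(ℝ, ℝ)) (u : L2) :
    inner ℂ ((vec f g).toLp 2 : L2) u
      = pairing u (complexify f) 0 + pairing u (complexify g) 1 := by
  have hi : ∀ (f : 𝓢(ℝ, ℝ)) (i : Fin 2), Integrable (fun x => complexify f x * u x i) :=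
    fun f i => integrable_schwartz_mul f (memLp_component u i)
  rw [pairing_eq, pairing_eq, ← integral_add (hi f 0) (hi g 1), L2.inner_def]
  refine integral_congr_ae ?_
  filter_upwards [(vec f g).coeFn_toLp 2] with x hx
  rw [hx, PiLp.inner_apply, Fin.sum_univ_two, vec_apply_zero, vec_apply_one, complexify_apply,
    complexify_apply]
  simp [mul_comm]

theorem pairing_toLp (ψ : 𝓢(ℝ, C2)) (φ : 𝓢(ℝ, ℂ)) (i : Fin 2) :
    pairing (ψ.toLp 2) φ i = ∫ x, φ x * ψ x i := by
  rw [pairing_eq]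
  refine integral_congr_ae ?_
  filter_upwards [ψ.coeFn_toLp 2] with x hx
  rw [hx]

theorem inner_vec_vec (f g f' g' : 𝓢(ℝ, ℝ)) :
    inner ℂ ((vec f g).toLp 2 : L2) ((vec f' g').toLp 2 : L2)
      = ((∫ x, f x * f' x) + ∫ x, g x * g' x : ℝ) := by
  rw [inner_vec, pairing_toLp, pairing_toLp]
  simp only [vec_apply_zero, vec_apply_one, complexify_apply]
  push_cast
  simp only [← Complex.ofReal_mul, integral_complex_ofReal]

variable (α : ℝ)

/-- The translated Hermite function `φ_N(x - β)`. -/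
def shiftHerm (β : ℝ) (N : ℕ) : 𝓢(ℝ, ℝ) := SchwartzMap.compSubConstCLM ℝ β (herm N)

theorem shiftHerm_apply (β : ℝ) (N : ℕ) (x : ℝ) : shiftHerm β N x = herm N (x - β) := rfl

/-- The first component of the eigenfunctions for `ε = 0`, without normalization. -/
def compA (k : ℕ × ℤˣ) : 𝓢(ℝ, ℝ) := shiftHerm (-α) k.1 + ((k.2 : ℤ) : ℝ) • shiftHerm α k.1

/-- The second component of the eigenfunctions for `ε = 0`, without normalization. -/
def compB (k : ℕ × ℤˣ) : 𝓢(ℝ, ℝ) := shiftHerm (-α) k.1 - ((k.2 : ℤ) : ℝ) • shiftHerm α k.1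

theorem compA_apply (k : ℕ × ℤˣ) (x : ℝ) :
    compA α k x = herm k.1 (x + α) + ((k.2 : ℤ) : ℝ) * herm k.1 (x - α) := by
  simp [compA, shiftHerm_apply]

theorem compB_apply (k : ℕ × ℤˣ) (x : ℝ) :
    compB α k x = herm k.1 (x + α) - ((k.2 : ℤ) : ℝ) * herm k.1 (x - α) := by
  simp [compB, shiftHerm_apply]

/-- The normalization factor. -/
def normFactor (N : ℕ) : ℝ := (2 * √(hermiteNormSq N))⁻¹

theorem normFactor_sq (N : ℕ) : normFactor N * normFactor N = (4 * hermiteNormSq N)⁻¹ := by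
  rw [normFactor, ← mul_inv]
  congr 1
  linear_combination 4 * Real.mul_self_sqrt (hermiteNormSq_pos N).le

theorem normFactor_ne_zero (N : ℕ) : normFactor N ≠ 0 := by
  have := Real.sqrt_pos.mpr (hermiteNormSq_pos N)
  rw [normFactor]; positivity

/-- The eigenfunctions for `ε = 0`. -/
def eigenVec (k : ℕ × ℤˣ) : L2 := (normFactor k.1 : ℂ) • ((vec (compA α k) (compB α k)).toLp 2 : L2)

theorem integral_shift_mul (β : ℝ) (N M : ℕ) :
    ∫ x, shiftHerm β N x * shiftHerm β M x = ∫ x, herm N x * herm M x :=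
  integral_sub_right_eq_self (fun x => herm N x * herm M x) β

/-- Products of oppositely shifted functions cancel between the two components, and translation
invariance removes the shifts from the rest. The factor `1 + s t` separates the two signs and
accounts for the `4` in the normalization. -/
theorem integral_comp_add (k l : ℕ × ℤˣ) :
    (∫ x, compA α k x * compA α l x) + ∫ x, compB α k x * compB α l x
      = 2 * (1 + ((k.2 : ℤ) : ℝ) * ((l.2 : ℤ) : ℝ)) * ∫ x, herm k.1 x * herm l.1 x := by
  rw [← integral_add (integrable_herm_mul _ _) (integrable_herm_mul _ _)]
  have e : ∀ x, compA α k x * compA α l x + compB α k x * compB α l x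
      = 2 * (shiftHerm (-α) k.1 x * shiftHerm (-α) l.1 x)
        + 2 * (((k.2 : ℤ) : ℝ) * ((l.2 : ℤ) : ℝ)) * (shiftHerm α k.1 x * shiftHerm α l.1 x) := by
    intro x
    simp only [compA, compB, add_apply, sub_apply, smul_apply, smul_eq_mul]
    ring
  simp only [e]
  rw [integral_add ((integrable_herm_mul _ _).const_mul _) ((integrable_herm_mul _ _).const_mul _),
    integral_const_mul, integral_const_mul, integral_shift_mul, integral_shift_mul]
  ring

theorem units_mul_self (s : ℤˣ) : ((s : ℤ) : ℝ) * ((s : ℤ) : ℝ) = 1 := by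
  rcases Int.units_eq_one_or s with rfl | rfl <;> norm_num

theorem units_mul_of_ne {s t : ℤˣ} (h : s ≠ t) : ((s : ℤ) : ℝ) * ((t : ℤ) : ℝ) = -1 := by
  rcases Int.units_eq_one_or s with rfl | rfl <;> rcases Int.units_eq_one_or t with rfl | rfl <;>
    simp_all

theorem inner_eigenVec (k l : ℕ × ℤˣ) :
    inner ℂ (eigenVec α k) (eigenVec α l) = if k = l then 1 else 0 := by
  rw [eigenVec, eigenVec, inner_smul_left, inner_smul_right, inner_vec_vec, integral_comp_add]
  obtain ⟨n, s⟩ := k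
  obtain ⟨m, t⟩ := l
  by_cases hnm : n = m
  · subst hnm
    by_cases hst : s = t
    · subst hst
      rw [if_pos rfl, ← hermiteNormSq_eq, units_mul_self, Complex.conj_ofReal, ← mul_assoc,
        ← Complex.ofReal_mul, normFactor_sq, ← Complex.ofReal_mul, ← Complex.ofReal_one]
      congr 1
      have := (hermiteNormSq_pos n).ne'
      field_simp
      norm_num
    · simp only
      rw [units_mul_of_ne hst]
      simp [hst]
  · simp only
    rw [integral_herm_mul_herm hnm]
    simp [hnm]

theorem orthonormal_eigenVec : Orthonormal ℂ (eigenVec α) := by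
  classical
  rw [orthonormal_iff_ite]
  intro k l
  simpa using inner_eigenVec α k l

theorem eq_zero_of_shift {w : ℝ → ℂ} (hw : MemLp w 2) (β : ℝ)
    (h : ∀ N, ∫ x, (shiftHerm β N x : ℂ) * w x = 0) : w =ᵐ[volume] 0 := by
  have hmp := measurePreserving_add_right (volume : Measure ℝ) β
  have h1 : MemLp (fun x => w (x + β)) 2 := hw.comp_measurePreserving hmp
  have h2 : (fun x => w (x + β)) =ᵐ[volume] 0 := by
    refine ae_eq_zero_of_integral_herm h1 fun N => ?_
    rw [← h N, ← integral_add_right_eq_self (fun x => (shiftHerm β N x : ℂ) * w x) β]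
    simp [shiftHerm_apply]
  have h3 :=
    (measurePreserving_sub_right (volume : Measure ℝ) β).quasiMeasurePreserving.ae_eq_comp h2
  filter_upwards [h3] with x hx
  simpa using hx

theorem eq_zero_of_inner_eigenVec (u : L2) (h : ∀ k, inner ℂ (eigenVec α k) u = 0) : u = 0 := by
  have h1 : ∀ k : ℕ × ℤˣ,
      (∫ x, (compA α k x : ℂ) * u x 0) + ∫ x, (compB α k x : ℂ) * u x 1 = 0 := by
    intro k
    have h2 := h k
    rw [eigenVec, inner_smul_left, inner_vec, pairing_eq, pairing_eq] at h2
    exact (mul_eq_zero.mp h2).resolve_left (by simpa using normFactor_ne_zero k.1)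
  have hi : ∀ (β : ℝ) (N : ℕ) (i : Fin 2), Integrable (fun x => (shiftHerm β N x : ℂ) * u x i) :=
    fun β N i => integrable_schwartz_mul _ (memLp_component u i)
  have h2 : ∀ (N : ℕ) (s : ℤˣ), (∫ x, (shiftHerm (-α) N x : ℂ) * (u x 0 + u x 1))
      + ((s : ℤ) : ℂ) * ∫ x, (shiftHerm α N x : ℂ) * (u x 0 - u x 1) = 0 := by
    intro N s
    rw [← h1 (N, s)]
    have e1 : ∀ x, (compA α (N, s) x : ℂ) * u x 0 = (shiftHerm (-α) N x : ℂ) * u x 0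
        + ((s : ℤ) : ℂ) * ((shiftHerm α N x : ℂ) * u x 0) := by
      intro x; simp [compA]; ring
    have e2 : ∀ x, (compB α (N, s) x : ℂ) * u x 1 = (shiftHerm (-α) N x : ℂ) * u x 1
        - ((s : ℤ) : ℂ) * ((shiftHerm α N x : ℂ) * u x 1) := by
      intro x; simp [compB]; ring
    simp only [e1, e2, mul_add, mul_sub]
    rw [integral_add (hi _ _ _) (hi _ _ _), integral_sub (hi _ _ _) (hi _ _ _),
      integral_add (hi _ _ _) ((hi _ _ _).const_mul _),
      integral_sub (hi _ _ _) ((hi _ _ _).const_mul _), integral_const_mul, integral_const_mul]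
    ring
  -- Adding and subtracting the relations for `s = 1` and `s = -1` isolates one shift at a time.
  have hp : (fun x => u x 0 + u x 1) =ᵐ[volume] 0 := by
    refine eq_zero_of_shift ((memLp_component u 0).add (memLp_component u 1)) (-α) fun N => ?_
    have a := h2 N 1
    have b := h2 N (-1)
    push_cast at a b
    linear_combination (a + b) / 2
  have hm : (fun x => u x 0 - u x 1) =ᵐ[volume] 0 := by
    refine eq_zero_of_shift ((memLp_component u 0).sub (memLp_component u 1)) α fun N => ?_
    have a := h2 N 1
    have b := h2 N (-1)
    push_cast at a b
    linear_combination (a - b) / 2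
  rw [Lp.eq_zero_iff_ae_eq_zero]
  filter_upwards [hp, hm] with x h3 h4
  simp only [Pi.zero_apply] at h3 h4 ⊢
  ext i
  fin_cases i
  · show u x 0 = 0
    linear_combination (h3 + h4) / 2
  · show u x 1 = 0
    linear_combination (h3 - h4) / 2

/-- The Hilbert basis of the eigenfunctions for `ε = 0`. -/
def eigenBasis : HilbertBasis (ℕ × ℤˣ) ℂ L2 :=
  HilbertBasis.mkOfOrthogonalEqBot (orthonormal_eigenVec α) (by
    rw [Submodule.eq_bot_iff]
    intro u hu
    refine eq_zero_of_inner_eigenVec α u fun k => ?_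
    exact (Submodule.mem_orthogonal _ _).mp hu _ (Submodule.subset_span ⟨k, rfl⟩))

theorem eigenBasis_apply (k : ℕ × ℤˣ) : eigenBasis α k = eigenVec α k := by
  rw [eigenBasis, HilbertBasis.coe_mkOfOrthogonalEqBot]

end Basis

/-! ### The maximal-domain operator in coordinates, its first-order matrix elements, and parity. -/

section Graph

variable (α γ₁ γ₂ ε : ℝ)

/-- `x² φ` for a Schwartz function `φ`. -/
abbrev mulSq (φ : 𝓢(ℝ, ℂ)) : 𝓢(ℝ, ℂ) := SchwartzMap.smulLeftCLM ℂ (fun x : ℝ => (x : ℂ) ^ 2) φ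

/-- `x φ` for a Schwartz function `φ`. -/
abbrev mulId (φ : 𝓢(ℝ, ℂ)) : 𝓢(ℝ, ℂ) := SchwartzMap.smulLeftCLM ℂ (fun x : ℝ => (x : ℂ)) φ

/-- The derivative of a Schwartz function. -/
abbrev derivS (φ : 𝓢(ℝ, ℂ)) : 𝓢(ℝ, ℂ) := SchwartzMap.derivCLM ℂ ℂ φ

theorem hasTemperateGrowth_ofReal : Function.HasTemperateGrowth (fun x : ℝ => (x : ℂ)) :=
  Complex.ofRealCLM.hasTemperateGrowth

theorem mulSq_apply (φ : 𝓢(ℝ, ℂ)) (x : ℝ) : mulSq φ x = (x : ℂ) ^ 2 * φ x := by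
  rw [mulSq, SchwartzMap.smulLeftCLM_apply_apply, smul_eq_mul]
  exact hasTemperateGrowth_ofReal.pow 2

theorem mulId_apply (φ : 𝓢(ℝ, ℂ)) (x : ℝ) : mulId φ x = (x : ℂ) * φ x := by
  rw [mulId, SchwartzMap.smulLeftCLM_apply_apply hasTemperateGrowth_ofReal, smul_eq_mul]

theorem rabiDistrib_apply (U : 𝓢'(ℝ, C2)) (φ : 𝓢(ℝ, ℂ)) :
    rabiDistrib α γ₁ γ₂ ε U φ = (1 / 2 : ℂ) • (U (mulSq φ) - U (derivS (derivS φ)))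
      + (α : ℂ) • Matrix.toEuclideanCLM (𝕜 := ℂ) !![0, 1; 1, 0] (U (mulId φ))
      + (ε : ℂ) • Matrix.toEuclideanCLM (𝕜 := ℂ) !![(γ₁ : ℂ), 0; 0, (γ₂ : ℂ)] (U φ) := by
  have h : rabiDistrib α γ₁ γ₂ ε U φ = (1 / 2 : ℂ) • (U (mulSq φ) - U (-derivS (-derivS φ)))
      + (α : ℂ) • Matrix.toEuclideanCLM (𝕜 := ℂ) !![0, 1; 1, 0] (U (mulId φ))
      + (ε : ℂ) • Matrix.toEuclideanCLM (𝕜 := ℂ) !![(γ₁ : ℂ), 0; 0, (γ₂ : ℂ)] (U φ) := rfl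
  have h2 : -derivS (-derivS φ) = derivS (derivS φ) := by
    rw [derivS, map_neg, neg_neg]
  rw [h, h2]

theorem rabiDistrib_apply_zero (U : 𝓢'(ℝ, C2)) (φ : 𝓢(ℝ, ℂ)) :
    rabiDistrib α γ₁ γ₂ ε U φ 0 = 1 / 2 * (U (mulSq φ) 0 - U (derivS (derivS φ)) 0)
      + α * U (mulId φ) 1 + ε * γ₁ * U φ 0 := by
  rw [rabiDistrib_apply]
  simp [Matrix.mulVec, dotProduct]
  ring

theorem rabiDistrib_apply_one (U : 𝓢'(ℝ, C2)) (φ : 𝓢(ℝ, ℂ)) :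
    rabiDistrib α γ₁ γ₂ ε U φ 1 = 1 / 2 * (U (mulSq φ) 1 - U (derivS (derivS φ)) 1)
      + α * U (mulId φ) 0 + ε * γ₂ * U φ 1 := by
  rw [rabiDistrib_apply]
  simp [Matrix.mulVec, dotProduct]
  ring

/-- The matrix `diag(γ₁, γ₂)` acting in `L²`. -/
def diagOp : L2 →L[ℂ] L2 :=
  (Matrix.toEuclideanCLM (𝕜 := ℂ) !![(γ₁ : ℂ), 0; 0, (γ₂ : ℂ)] : C2 →L[ℂ] C2).compLpL 2 volume

theorem diagOp_ae (u : L2) :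
    ∀ᵐ x, diagOp γ₁ γ₂ u x 0 = γ₁ * u x 0 ∧ diagOp γ₁ γ₂ u x 1 = γ₂ * u x 1 := by
  filter_upwards [ContinuousLinearMap.coeFn_compLpL (p := 2) (μ := volume)
    (Matrix.toEuclideanCLM (𝕜 := ℂ) !![(γ₁ : ℂ), 0; 0, (γ₂ : ℂ)] : C2 →L[ℂ] C2) u] with x hx
  rw [diagOp, hx]
  simp [Matrix.mulVec, dotProduct]

theorem pairing_diagOp_zero (u : L2) (φ : 𝓢(ℝ, ℂ)) :
    pairing (diagOp γ₁ γ₂ u) φ 0 = γ₁ * pairing u φ 0 := by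
  rw [pairing_eq, pairing_eq, ← integral_const_mul]
  refine integral_congr_ae ?_
  filter_upwards [diagOp_ae γ₁ γ₂ u] with x hx
  rw [hx.1]; ring

theorem pairing_diagOp_one (u : L2) (φ : 𝓢(ℝ, ℂ)) :
    pairing (diagOp γ₁ γ₂ u) φ 1 = γ₂ * pairing u φ 1 := by
  rw [pairing_eq, pairing_eq, ← integral_const_mul]
  refine integral_congr_ae ?_
  filter_upwards [diagOp_ae γ₁ γ₂ u] with x hx
  rw [hx.2]; ring

theorem distrib_ext {U V : 𝓢'(ℝ, C2)} (h0 : ∀ φ, U φ 0 = V φ 0) (h1 : ∀ φ, U φ 1 = V φ 1) :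
    U = V := by
  ext φ i
  fin_cases i
  · exact h0 φ
  · exact h1 φ

theorem rabiDistrib_eq_add (u : L2) :
    rabiDistrib α γ₁ γ₂ ε (u : 𝓢'(ℝ, C2))
      = rabiDistrib α γ₁ γ₂ 0 (u : 𝓢'(ℝ, C2))
        + (ε : ℂ) • ((diagOp γ₁ γ₂ u : L2) : 𝓢'(ℝ, C2)) := by
  refine distrib_ext (fun φ => ?_) fun φ => ?_
  · have := pairing_diagOp_zero γ₁ γ₂ u φ
    simp only [pairing] at this
    rw [rabiDistrib_apply_zero, add_apply, smul_apply, PiLp.add_apply, PiLp.smul_apply,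
      rabiDistrib_apply_zero, this, smul_eq_mul]
    push_cast; ring
  · have := pairing_diagOp_one γ₁ γ₂ u φ
    simp only [pairing] at this
    rw [rabiDistrib_apply_one, add_apply, smul_apply, PiLp.add_apply, PiLp.smul_apply,
      rabiDistrib_apply_one, this, smul_eq_mul]
    push_cast; ring

/-- The eigenvalues for `ε = 0`. -/
def level (n : ℕ) : ℝ := n + 1 / 2 - α ^ 2 / 2

theorem deriv_shiftHerm (β : ℝ) (N : ℕ) (x : ℝ) :
    deriv (shiftHerm β N) x = deriv (herm N) (x - β) :=
  deriv_comp_sub_const (herm N) β x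

theorem deriv_deriv_shiftHerm (β : ℝ) (N : ℕ) (x : ℝ) :
    deriv (deriv (shiftHerm β N)) x = deriv (deriv (herm N)) (x - β) := by
  have : deriv (shiftHerm β N) = fun x => deriv (herm N) (x - β) := funext (deriv_shiftHerm β N)
  rw [this, deriv_comp_sub_const (deriv (herm N)) β x]

/-- The second derivative as an operator on real Schwartz functions. -/
abbrev derivTwo (f : 𝓢(ℝ, ℝ)) : 𝓢(ℝ, ℝ) := SchwartzMap.derivCLM ℝ ℝ (SchwartzMap.derivCLM ℝ ℝ f)

theorem derivTwo_apply (f : 𝓢(ℝ, ℝ)) (x : ℝ) : derivTwo f x = deriv (deriv f) x := by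
  rw [derivTwo, SchwartzMap.derivCLM_apply]
  congr 1

/-- This is the oscillator equation at `x - β` with `(x - β)²` expanded; the cross term becomes the
linear coupling and `β²/2` the shift of the level. -/
theorem shiftHerm_eq (β : ℝ) (N : ℕ) (x : ℝ) :
    1 / 2 * (x ^ 2 * shiftHerm β N x - derivTwo (shiftHerm β N) x) - β * x * shiftHerm β N x
      = (N + 1 / 2 - β ^ 2 / 2) * shiftHerm β N x := by
  rw [derivTwo_apply, deriv_deriv_shiftHerm, shiftHerm_apply]
  linear_combination (1 / 2) * herm_hamiltonian N (x - β)

theorem comp_eq_A (k : ℕ × ℤˣ) (x : ℝ) :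
    1 / 2 * (x ^ 2 * compA α k x - derivTwo (compA α k) x) + α * x * compB α k x
      = level α k.1 * compA α k x := by
  have h1 := shiftHerm_eq (-α) k.1 x
  have h2 := shiftHerm_eq α k.1 x
  simp only [compA, compB, derivTwo, map_add, map_smul, add_apply, sub_apply, smul_apply,
    smul_eq_mul, level] at *
  linear_combination h1 + ((k.2 : ℤ) : ℝ) * h2

theorem comp_eq_B (k : ℕ × ℤˣ) (x : ℝ) :
    1 / 2 * (x ^ 2 * compB α k x - derivTwo (compB α k) x) + α * x * compA α k x
      = level α k.1 * compB α k x := by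
  have h1 := shiftHerm_eq (-α) k.1 x
  have h2 := shiftHerm_eq α k.1 x
  simp only [compA, compB, derivTwo, map_sub, map_smul, add_apply, sub_apply, smul_apply,
    smul_eq_mul, level] at *
  linear_combination h1 - ((k.2 : ℤ) : ℝ) * h2

theorem derivS_complexify (f : 𝓢(ℝ, ℝ)) :
    derivS (complexify f) = complexify (SchwartzMap.derivCLM ℝ ℝ f) := by
  ext x
  exact (f.hasDerivAt x).ofReal_comp.deriv

theorem complexify_comp_eq {f g : 𝓢(ℝ, ℝ)} {e : ℝ}
    (h : ∀ x, 1 / 2 * (x ^ 2 * f x - derivTwo f x) + α * x * g x = e * f x) :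
    (1 / 2 : ℂ) • (mulSq (complexify f) - derivS (derivS (complexify f)))
      + (α : ℂ) • mulId (complexify g) = (e : ℂ) • complexify f := by
  ext x
  rw [derivS_complexify, derivS_complexify]
  simp only [add_apply, sub_apply, smul_apply, mulSq_apply, mulId_apply, complexify_apply,
    smul_eq_mul]
  have := congrArg (fun t : ℝ => (t : ℂ)) (h x)
  push_cast at this
  linear_combination this

/-- The Hamiltonian is formally symmetric. -/
theorem integral_comp_eq {f g : 𝓢(ℝ, ℝ)} {e : ℝ}
    (h : ∀ x, 1 / 2 * (x ^ 2 * f x - derivTwo f x) + α * x * g x = e * f x) (φ : 𝓢(ℝ, ℂ)) :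
    1 / 2 * ((∫ x, mulSq φ x * complexify f x) - ∫ x, derivS (derivS φ) x * complexify f x)
      + α * ∫ x, mulId φ x * complexify g x = e * ∫ x, φ x * complexify f x := by
  have hi : ∀ φ χ : 𝓢(ℝ, ℂ), Integrable (fun x => φ x * χ x) := fun φ χ =>
    (φ.memLp 2).integrable_mul (χ.memLp 2)
  have hp : ∀ φ χ : 𝓢(ℝ, ℂ), ∫ x, derivS φ x * χ x = - ∫ x, φ x * derivS χ x := by
    intro φ χ
    have := SchwartzMap.integral_mul_deriv_eq_neg_deriv_mul φ χ
    simp only [SchwartzMap.derivCLM_apply]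
    rw [this, neg_neg]
  have h2 := complexify_comp_eq α h
  rw [hp, hp, neg_neg]
  have e1 : ∫ x, mulSq φ x * complexify f x = ∫ x, φ x * mulSq (complexify f) x := by
    congr 1; funext x; rw [mulSq_apply, mulSq_apply]; ring
  have e2 : ∫ x, mulId φ x * complexify g x = ∫ x, φ x * mulId (complexify g) x := by
    congr 1; funext x; rw [mulId_apply, mulId_apply]; ring
  have hs : Integrable (fun x => φ x * mulSq (complexify f) x
      - φ x * derivS (derivS (complexify f)) x) := (hi _ _).sub (hi _ _)
  rw [e1, e2, ← integral_sub (hi _ _) (hi _ _), ← integral_const_mul, ← integral_const_mul,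
    ← integral_const_mul, ← integral_add (hs.const_mul _) ((hi _ _).const_mul _)]
  congr 1
  funext x
  have h3 := congrArg (fun q : 𝓢(ℝ, ℂ) => q x) h2
  simp only [add_apply, sub_apply, smul_apply, smul_eq_mul] at h3
  linear_combination φ x * h3

theorem rabiDistrib_eigenVec (k : ℕ × ℤˣ) :
    rabiDistrib α γ₁ γ₂ 0 ((eigenVec α k : L2) : 𝓢'(ℝ, C2))
      = (level α k.1 : ℂ) • ((eigenVec α k : L2) : 𝓢'(ℝ, C2)) := by
  set v : L2 := (vec (compA α k) (compB α k)).toLp 2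
  have h : rabiDistrib α γ₁ γ₂ 0 (v : 𝓢'(ℝ, C2)) = (level α k.1 : ℂ) • (v : 𝓢'(ℝ, C2)) := by
    have p0 : ∀ φ, (v : 𝓢'(ℝ, C2)) φ 0 = ∫ x, φ x * complexify (compA α k) x := fun φ => by
      rw [← pairing, pairing_toLp]; simp only [vec_apply_zero, complexify_apply]
    have p1 : ∀ φ, (v : 𝓢'(ℝ, C2)) φ 1 = ∫ x, φ x * complexify (compB α k) x := fun φ => by
      rw [← pairing, pairing_toLp]; simp only [vec_apply_one, complexify_apply]
    refine distrib_ext (fun φ => ?_) fun φ => ?_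
    · rw [rabiDistrib_apply_zero, smul_apply, PiLp.smul_apply, smul_eq_mul]
      simp only [p0, p1]
      rw [← integral_comp_eq α (comp_eq_A α k)]
      simp
    · rw [rabiDistrib_apply_one, smul_apply, PiLp.smul_apply, smul_eq_mul]
      simp only [p0, p1]
      rw [← integral_comp_eq α (comp_eq_B α k)]
      simp
  have hv : ((eigenVec α k : L2) : 𝓢'(ℝ, C2)) = (normFactor k.1 : ℂ) • (v : 𝓢'(ℝ, C2)) :=
    map_smul (Lp.toTemperedDistributionCLM C2 volume 2) _ _
  rw [hv, map_smul, h, smul_comm]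

theorem inner_eigenVec_of_rabiDistrib {u f : L2}
    (h : rabiDistrib α γ₁ γ₂ 0 (u : 𝓢'(ℝ, C2)) = (f : 𝓢'(ℝ, C2))) (k : ℕ × ℤˣ) :
    (level α k.1 : ℂ) * inner ℂ (eigenVec α k) u = inner ℂ (eigenVec α k) f := by
  rw [eigenVec, inner_smul_left, inner_smul_left, inner_vec, inner_vec, mul_left_comm]
  congr 1
  simp only [pairing]
  rw [← h, rabiDistrib_apply_zero, rabiDistrib_apply_one]
  have hA := congrArg (fun q => (u : 𝓢'(ℝ, C2)) q 0) (complexify_comp_eq α (comp_eq_A α k))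
  have hB := congrArg (fun q => (u : 𝓢'(ℝ, C2)) q 1) (complexify_comp_eq α (comp_eq_B α k))
  simp only [map_add, map_sub, map_smul, PiLp.add_apply, PiLp.sub_apply, PiLp.smul_apply,
    smul_eq_mul] at hA hB
  push_cast
  linear_combination -hA - hB

/-- Forward: the distributional equation is tested against the eigenfunctions, which are Schwartz.
Backward: the expansions of `u` and `f` converge in `L²`, hence as tempered distributions, and the
differential expression may be applied term by term. No separate proof of self-adjointness is
needed. -/
theorem rabiDistrib_zero_iff {u f : L2} :
    rabiDistrib α γ₁ γ₂ 0 (u : 𝓢'(ℝ, C2)) = (f : 𝓢'(ℝ, C2)) ↔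
      ∀ k, (level α k.1 : ℂ) * inner ℂ (eigenVec α k) u = inner ℂ (eigenVec α k) f := by
  refine ⟨fun h k => inner_eigenVec_of_rabiDistrib α γ₁ γ₂ h k, fun h => ?_⟩
  set T := Lp.toTemperedDistributionCLM C2 (volume : Measure ℝ) 2
  have h1 := (rabiDistrib α γ₁ γ₂ 0 ∘L T).hasSum ((eigenBasis α).hasSum_repr u)
  have h2 := T.hasSum ((eigenBasis α).hasSum_repr f)
  have e : ∀ k, (rabiDistrib α γ₁ γ₂ 0 ∘L T) ((eigenBasis α).repr u k • eigenBasis α k)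
      = T ((eigenBasis α).repr f k • eigenBasis α k) := by
    intro k
    have h3 : rabiDistrib α γ₁ γ₂ 0 (T (eigenVec α k)) = (level α k.1 : ℂ) • T (eigenVec α k) :=
      rabiDistrib_eigenVec α γ₁ γ₂ k
    rw [HilbertBasis.repr_apply_apply, HilbertBasis.repr_apply_apply, eigenBasis_apply, ← h k,
      map_smul, map_smul, ContinuousLinearMap.comp_apply, h3, smul_smul, mul_comm]
  simp only [e] at h1
  exact h1.unique h2

theorem mem_graph_rabi_iff {u f : L2} :
    (u, f) ∈ (rabi α γ₁ γ₂ ε).graph ↔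
      ∀ k, (level α k.1 : ℂ) * inner ℂ (eigenBasis α k) u
        + ε * inner ℂ (eigenBasis α k) (diagOp γ₁ γ₂ u) = inner ℂ (eigenBasis α k) f := by
  have h : ((f - (ε : ℂ) • diagOp γ₁ γ₂ u : L2) : 𝓢'(ℝ, C2))
      = (f : 𝓢'(ℝ, C2)) - (ε : ℂ) • ((diagOp γ₁ γ₂ u : L2) : 𝓢'(ℝ, C2)) := by
    have := map_sub (Lp.toTemperedDistributionCLM C2 (volume : Measure ℝ) 2) f
      ((ε : ℂ) • diagOp γ₁ γ₂ u)
    rw [map_smul] at this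
    exact this
  rw [mem_graph_rabi, rabiDistrib_eq_add, ← eq_sub_iff_add_eq, ← h, rabiDistrib_zero_iff]
  refine forall_congr' fun k => ?_
  rw [inner_sub_right, inner_smul_right, eq_sub_iff_add_eq, eigenBasis_apply]

theorem diagOp_symm (u v : L2) : inner ℂ (diagOp γ₁ γ₂ u) v = inner ℂ u (diagOp γ₁ γ₂ v) := by
  rw [L2.inner_def, L2.inner_def]
  refine integral_congr_ae ?_
  filter_upwards [diagOp_ae γ₁ γ₂ u, diagOp_ae γ₁ γ₂ v] with x hu hv
  simp only [PiLp.inner_apply, Fin.sum_univ_two, hu.1, hu.2, hv.1, hv.2]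
  simp
  ring

/-- The squared norms of the two components are `2‖φ‖² ± 2 s · overlap`; `γ₁` and `γ₂` weight them,
so the overlap survives only with the factor `γ₁ - γ₂`. -/
theorem inner_eigenVec_diagOp (k : ℕ × ℤˣ) :
    inner ℂ (eigenVec α k) (diagOp γ₁ γ₂ (eigenVec α k))
      = (((γ₁ + γ₂) / 2 + ((k.2 : ℤ) : ℝ) * ((γ₁ - γ₂) / 2)
          * (overlap α k.1 / hermiteNormSq k.1) : ℝ) : ℂ) := by
  have hn := (hermiteNormSq_pos k.1).ne'
  rw [eigenVec, map_smul, inner_smul_left, inner_smul_right, inner_vec, pairing_diagOp_zero,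
    pairing_diagOp_one, pairing_toLp, pairing_toLp]
  simp only [vec_apply_zero, vec_apply_one, complexify_apply]
  simp only [← Complex.ofReal_mul, integral_complex_ofReal, Complex.conj_ofReal]
  rw [← Complex.ofReal_add, ← Complex.ofReal_mul, ← Complex.ofReal_mul]
  congr 1
  have i0 : ∀ β, ∫ x, shiftHerm β k.1 x * shiftHerm β k.1 x = hermiteNormSq k.1 := fun β => by
    rw [integral_shift_mul, hermiteNormSq_eq]
  have i1 : ∫ x, shiftHerm (-α) k.1 x * shiftHerm α k.1 x = overlap α k.1 := by
    rw [overlap, ← coe_herm]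
    congr 1; funext x
    rw [shiftHerm_apply, shiftHerm_apply, sub_neg_eq_add, mul_comm]
  have iA : ∫ x, compA α k x * compA α k x
      = 2 * hermiteNormSq k.1 + 2 * ((k.2 : ℤ) : ℝ) * overlap α k.1 := by
    have e : ∀ x, compA α k x * compA α k x = shiftHerm (-α) k.1 x * shiftHerm (-α) k.1 x
        + shiftHerm α k.1 x * shiftHerm α k.1 x
        + 2 * ((k.2 : ℤ) : ℝ) * (shiftHerm (-α) k.1 x * shiftHerm α k.1 x) := by
      intro x
      simp only [compA, add_apply, smul_apply, smul_eq_mul]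
      linear_combination (shiftHerm α k.1 x * shiftHerm α k.1 x) * units_mul_self k.2
    simp only [e]
    rw [integral_add ((integrable_herm_mul _ _).fun_add (integrable_herm_mul _ _))
      ((integrable_herm_mul _ _).const_mul _), integral_add (integrable_herm_mul _ _)
      (integrable_herm_mul _ _), integral_const_mul, i0, i0, i1]
    ring
  have iB : ∫ x, compB α k x * compB α k x
      = 2 * hermiteNormSq k.1 - 2 * ((k.2 : ℤ) : ℝ) * overlap α k.1 := by
    have := integral_comp_add α k k
    rw [units_mul_self, ← hermiteNormSq_eq, iA] at this
    linarith
  rw [iA, iB, ← mul_assoc, normFactor_sq]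
  field_simp
  ring

/-- The parity operator as a bounded operator. -/
def parityCLM : L2 →L[ℂ] L2 :=
  ((Matrix.toEuclideanCLM (𝕜 := ℂ) !![1, 0; 0, -1] : C2 →L[ℂ] C2).compLpL 2
      (volume : Measure ℝ)) ∘L
    (Lp.compMeasurePreservingₗᵢ ℂ (fun x : ℝ => -x)
      (Measure.measurePreserving_neg volume)).toContinuousLinearMap

theorem parityCLM_apply (u : L2) : parityCLM u = parityOp u := rfl

theorem mem_paritySector {p : ℤˣ} {u : L2} :
    u ∈ paritySector p ↔ parityCLM u = (((p : ℤ) : ℂ)) • u := by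
  rw [paritySector, LinearMap.mem_ker, LinearMap.sub_apply, sub_eq_zero, parityCLM_apply]
  rfl

theorem parityCLM_ae (u : L2) :
    ∀ᵐ x, parityCLM u x 0 = u (-x) 0 ∧ parityCLM u x 1 = -u (-x) 1 := by
  have h1 := ContinuousLinearMap.coeFn_compLpL (p := 2) (μ := (volume : Measure ℝ))
    (Matrix.toEuclideanCLM (𝕜 := ℂ) !![1, 0; 0, -1] : C2 →L[ℂ] C2)
    (Lp.compMeasurePreserving (fun x : ℝ => -x) (Measure.measurePreserving_neg volume) u)
  have h2 := Lp.coeFn_compMeasurePreserving u (Measure.measurePreserving_neg (volume : Measure ℝ))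
  filter_upwards [h1, h2] with x hx hx2
  have : parityCLM u x = _ := hx
  rw [this, hx2]
  simp [Matrix.mulVec, dotProduct]

theorem ae_neg {p : ℝ → Prop} (h : ∀ᵐ x, p x) : ∀ᵐ x, p (-x) :=
  (Measure.measurePreserving_neg (volume : Measure ℝ)).quasiMeasurePreserving.ae h

theorem L2_ext {u v : L2} (h : ∀ᵐ x, u x 0 = v x 0 ∧ u x 1 = v x 1) : u = v := by
  apply Lp.ext
  filter_upwards [h] with x hx
  ext i
  fin_cases i
  · exact hx.1
  · exact hx.2

theorem parityCLM_diagOp (u : L2) :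
    parityCLM (diagOp γ₁ γ₂ u) = diagOp γ₁ γ₂ (parityCLM u) := by
  apply L2_ext
  filter_upwards [parityCLM_ae (diagOp γ₁ γ₂ u), diagOp_ae γ₁ γ₂ (parityCLM u), parityCLM_ae u,
    ae_neg (diagOp_ae γ₁ γ₂ u)] with x h1 h2 h3 h4
  rw [h1.1, h1.2, h2.1, h2.2, h3.1, h3.2, h4.1, h4.2]
  exact ⟨rfl, by ring⟩

/-- Reflection exchanges the shifts by `α` and `-α` and contributes `(-1)^N`; the sign of the second
parity component matches the antisymmetry of `compB`. -/
theorem parityCLM_eigenVec (k : ℕ × ℤˣ) :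
    parityCLM (eigenVec α k) = ((parityOf k : ℤ) : ℂ) • eigenVec α k := by
  set v : L2 := (vec (compA α k) (compB α k)).toLp 2 with hv
  have h : parityCLM v = ((parityOf k : ℤ) : ℂ) • v := by
    apply L2_ext
    have hc := (vec (compA α k) (compB α k)).coeFn_toLp 2
    have hp : ((parityOf k : ℤ) : ℝ) = ((k.2 : ℤ) : ℝ) * (-1) ^ k.1 := by
      simp [parityOf]
    have hs := units_mul_self k.2
    filter_upwards [parityCLM_ae v, Lp.coeFn_smul (((parityOf k : ℤ) : ℂ)) v, hc, ae_neg hc]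
      with x h1 h2 h3 h4
    rw [h1.1, h1.2, h2, Pi.smul_apply, PiLp.smul_apply, PiLp.smul_apply, hv, h3, h4,
      vec_apply_zero, vec_apply_zero, vec_apply_one, vec_apply_one, smul_eq_mul, smul_eq_mul]
    have n1 : herm k.1 (-x + α) = (-1) ^ k.1 * herm k.1 (x - α) := by rw [← herm_neg]; congr 1; ring
    have n2 : herm k.1 (-x - α) = (-1) ^ k.1 * herm k.1 (x + α) := by rw [← herm_neg]; congr 1; ring
    have eA : compA α k (-x) = ((parityOf k : ℤ) : ℝ) * compA α k x := by
      rw [compA_apply, compA_apply, hp, n1, n2]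
      linear_combination -(-1) ^ k.1 * herm k.1 (x - α) * hs
    have eB : -compB α k (-x) = ((parityOf k : ℤ) : ℝ) * compB α k x := by
      rw [compB_apply, compB_apply, hp, n1, n2]
      linear_combination (-1) ^ k.1 * herm k.1 (x - α) * hs
    constructor
    · rw [eA]; push_cast; ring
    · rw [← Complex.ofReal_neg, eB]; push_cast; ring
  rw [eigenVec, map_smul, h, smul_comm]

theorem parityCLM_eigenBasis (k : ℕ × ℤˣ) :
    parityCLM (eigenBasis α k) = ((parityOf k : ℤ) : ℂ) • eigenBasis α k := by
  rw [eigenBasis_apply, parityCLM_eigenVec]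

end Graph

/-! ### From coordinate equations to spectrum, eigenspaces and multiplicities. -/

section Spectrum

theorem mem_eigenspace_iff {T : L2 →ₗ.[ℂ] L2} {z : ℂ} {u : L2} :
    u ∈ eigenspace T z ↔ (u, z • u) ∈ T.graph := by
  rw [eigenspace, Submodule.mem_map, LinearPMap.mem_graph_iff]
  constructor
  · rintro ⟨y, hy, rfl⟩
    exact ⟨y, rfl, sub_eq_zero.mp hy⟩
  · rintro ⟨y, hy1, hy2⟩
    refine ⟨y, ?_, hy1⟩
    rw [LinearMap.mem_ker, LinearMap.sub_apply, sub_eq_zero]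
    simp only at hy1 hy2
    show T y = z • (y : L2)
    rw [hy2, hy1]

theorem mem_resolventSet_of {T : L2 →ₗ.[ℂ] L2} {z : ℂ} (R : L2 →L[ℂ] L2)
    (hR : ∀ f, (R f, f + z • R f) ∈ T.graph) (h0 : ∀ u, (u, z • u) ∈ T.graph → u = 0) :
    z ∈ resolventSet T := by
  refine ⟨R, fun f => ?_, fun u => ?_⟩
  · obtain ⟨y, hy1, hy2⟩ := (LinearPMap.mem_graph_iff _).mp (hR f)
    simp only at hy1 hy2
    have hm : R f ∈ T.domain := hy1 ▸ y.2
    refine ⟨hm, ?_⟩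
    have : y = ⟨R f, hm⟩ := Subtype.ext hy1
    rw [← this, hy2, add_sub_cancel_right]
  · have h1 := hR (T u - z • (u : L2))
    have h2 : ((u : L2), T u) ∈ T.graph := LinearPMap.mem_graph T u
    have h3 := T.graph.sub_mem h1 h2
    rw [Prod.mk_sub_mk] at h3
    refine sub_eq_zero.mp (h0 _ ?_)
    convert h3 using 2
    module

theorem mem_spec_of_eigenspace_ne_bot {T : L2 →ₗ.[ℂ] L2} {z : ℂ} (h : eigenspace T z ≠ ⊥) :
    z ∈ spec T := by
  rintro ⟨R, -, hR⟩
  apply h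
  rw [Submodule.eq_bot_iff]
  intro u hu
  obtain ⟨y, hy1, hy2⟩ := (LinearPMap.mem_graph_iff _).mp (mem_eigenspace_iff.mp hu)
  have h2 := hR y
  simp only at hy1 hy2
  rw [hy2, hy1, sub_self, map_zero] at h2
  exact h2.symm

variable {α γ₁ γ₂ ε : ℝ}

/-- Measuring the spectral parameter from level `N` puts both the resolvent and the eigenvalue
equation into the form treated by the abstract reduction. -/
theorem mem_graph_iff_diagEq (N : ℕ) (ζ : ℝ) (u f : L2) :
    (u, f + ((level α N + ζ : ℝ) : ℂ) • u) ∈ (rabi α γ₁ γ₂ ε).graph ↔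
      DiagEq (eigenBasis α) N (pert (diagOp γ₁ γ₂) (ε, ζ)) u f := by
  rw [mem_graph_rabi_iff]
  refine forall_congr' fun k => ?_
  rw [pert_apply, inner_add_right, inner_sub_right, inner_smul_right, inner_smul_right,
    inner_smul_right]
  simp only [level]
  push_cast
  constructor <;> intro h <;> linear_combination h

theorem mem_eigenspace_iff_diagEq (N : ℕ) (ζ : ℝ) (u : L2) :
    u ∈ eigenspace (rabi α γ₁ γ₂ ε) ((level α N + ζ : ℝ) : ℂ) ↔
      DiagEq (eigenBasis α) N (pert (diagOp γ₁ γ₂) (ε, ζ)) u 0 := by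
  rw [mem_eigenspace_iff, ← mem_graph_iff_diagEq, zero_add]

theorem level_zero_le (n : ℕ) : 1 / 2 - α ^ 2 / 2 ≤ level α n := by
  rw [level]
  have : (0 : ℝ) ≤ n := n.cast_nonneg
  linarith

/-- Such an `x` is at distance at least `1/2` from every level, so the free resolvent has norm at
most 2 and `2 · 1/10 < 1` makes the Neumann series converge. -/
theorem mem_resolventSet_of_lt (hε : |ε| * ‖diagOp γ₁ γ₂‖ ≤ 1 / 10) {x : ℝ}
    (hx : x < -(α ^ 2 / 2)) : (x : ℂ) ∈ resolventSet (rabi α γ₁ γ₂ ε) := by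
  set W := diagOp γ₁ γ₂
  have hpos : ∀ n, 1 / 2 ≤ level α n - x := fun n => by
    have := level_zero_le (α := α) n
    linarith
  have hne : ∀ n, (level α n : ℂ) - x ≠ 0 := fun n => by
    rw [← Complex.ofReal_sub]
    have := hpos n
    exact_mod_cast (by linarith : (0 : ℝ) < level α n - x).ne'
  have hb : ∀ k : ℕ × ℤˣ, ‖((level α k.1 : ℂ) - x)⁻¹‖ ≤ 2 := fun k => by
    rw [← Complex.ofReal_sub, norm_inv, Complex.norm_real, Real.norm_eq_abs,
      abs_of_nonneg (by linarith [hpos k.1])]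
    rw [inv_le_comm₀ (by linarith [hpos k.1]) (by norm_num)]
    linarith [hpos k.1]
  set D : L2 →L[ℂ] L2 :=
    diagCLM (eigenBasis α) (fun k => ((level α k.1 : ℂ) - x)⁻¹) 2 zero_le_two hb
  have hD : ∀ k u, inner ℂ (eigenBasis α k) (D u)
      = ((level α k.1 : ℂ) - x)⁻¹ * inner ℂ (eigenBasis α k) u := fun k u => inner_diagCLM ..
  have hnorm : ‖(ε : ℂ) • (D * W)‖ < 1 := by
    rw [norm_smul, Complex.norm_real, Real.norm_eq_abs]
    calc |ε| * ‖D * W‖ ≤ |ε| * (2 * ‖W‖) := by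
          gcongr
          exact (norm_mul_le _ _).trans (by gcongr; exact norm_diagCLM_le ..)
      _ < 1 := by linarith
  have hU := isUnit_one_add hnorm
  have key : ∀ u f : L2, (u, f + (x : ℂ) • u) ∈ (rabi α γ₁ γ₂ ε).graph ↔
      (1 + (ε : ℂ) • (D * W)) u = D f := by
    intro u f
    have e : (1 + (ε : ℂ) • (D * W)) u = u + (ε : ℂ) • D (W u) := rfl
    rw [mem_graph_rabi_iff, e]
    constructor
    · intro h
      refine hilbertBasis_ext (eigenBasis α) fun k => ?_
      have h1 := h k
      rw [inner_add_right, inner_smul_right] at h1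
      rw [inner_add_right, inner_smul_right, hD, hD]
      have := hne k.1
      field_simp
      linear_combination h1
    · intro h k
      have h1 := congrArg (fun v => inner ℂ (eigenBasis α k) v) h
      rw [inner_add_right, inner_smul_right, hD, hD] at h1
      have := hne k.1
      field_simp at h1
      rw [inner_add_right, inner_smul_right]
      linear_combination h1
  refine mem_resolventSet_of (Ring.inverse (1 + (ε : ℂ) • (D * W)) * D) (fun f => ?_) fun u hu => ?_
  · rw [key]
    have := congrArg (fun S : L2 →L[ℂ] L2 => S (D f)) (Ring.mul_inverse_cancel _ hU)
    exact this
  · have h1 := (key u 0).mp (by rwa [zero_add])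
    rw [map_zero] at h1
    have := congrArg (fun S : L2 →L[ℂ] L2 => S u) (Ring.inverse_mul_cancel _ hU)
    have h2 : Ring.inverse (1 + (ε : ℂ) • (D * W)) ((1 + (ε : ℂ) • (D * W)) u) = u := this
    rw [← h2, h1, map_zero]

theorem neg_le_of_mem_rabiSpec (hε : |ε| * ‖diagOp γ₁ γ₂‖ ≤ 1 / 10) {x : ℝ}
    (hx : x ∈ rabiSpec α γ₁ γ₂ ε) : -(α ^ 2 / 2) ≤ x := by
  by_contra! h
  exact hx (mem_resolventSet_of_lt hε h)

theorem toENat_rank_span {ι : Type} [Fintype ι] {v : ι → L2} (hv : LinearIndependent ℂ v) :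
    Cardinal.toENat (Module.rank ℂ (Submodule.span ℂ (range v))) = Fintype.card ι := by
  rw [rank_span hv, Cardinal.mk_range_eq v hv.injective, Cardinal.mk_fintype]
  simp

/-! ### Counting the eigenvalues in one interval. -/

section Level

variable {N : ℕ} {ζ : ℤˣ → ℝ} (hε : |ε| * ‖diagOp γ₁ γ₂‖ ≤ 1 / 10) (hζ : ∀ s, |ζ s| < 1 / 2)
  (hroot : ∀ s : ℤˣ, ∀ z : ℝ, |z| ≤ 1 / 2 →
    (secular (eigenBasis α) N s (pert (diagOp γ₁ γ₂) (ε, z)) = 0 ↔ z = ζ s))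

/-- The perturbed eigenvectors near the level `N`. -/
def branchVec (α γ₁ γ₂ ε : ℝ) (N : ℕ) (ζ : ℤˣ → ℝ) (s : ℤˣ) : L2 :=
  inv1 (eigenBasis α) N (pert (diagOp γ₁ γ₂) (ε, ζ s)) (eigenBasis α (N, s))

theorem mem_shiftedInterval_iff {x : ℝ} :
    x ∈ shiftedInterval α N ↔ -(1 / 2) ≤ x - level α N ∧ x - level α N < 1 / 2 := by
  rw [shiftedInterval, mem_Ico, level]
  constructor <;> rintro ⟨h1, h2⟩ <;> constructor <;> linarith

theorem parityCLM_pert (p : ℝ × ℝ) (u : L2) :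
    parityCLM (pert (diagOp γ₁ γ₂) p u) = pert (diagOp γ₁ γ₂) p (parityCLM u) := by
  rw [pert_apply, pert_apply, map_sub, map_smul, map_smul, parityCLM_diagOp]

include hε in
theorem isUnit_pert_of_le {z : ℝ} (hz : |z| ≤ 1 / 2) :
    IsUnit (1 + redRes (eigenBasis α) N * pert (diagOp γ₁ γ₂) (ε, z)) :=
  isUnit_pert (by simp only; linarith)

include hζ in
theorem level_add_mem_shiftedInterval (s : ℤˣ) : level α N + ζ s ∈ shiftedInterval α N := by
  rw [mem_shiftedInterval_iff, add_sub_cancel_left]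
  exact ⟨(abs_lt.mp (hζ s)).1.le, (abs_lt.mp (hζ s)).2⟩

-- A coefficient on branch `s` can be nonzero only if `x` is the root of that branch. All
-- eigenvectors in the interval therefore lie in the span of the same two vectors, whether or not
-- the two roots coincide.
include hε hroot in
theorem eigenspace_eq_sum {x : ℝ} (hx : x ∈ shiftedInterval α N) {u : L2}
    (hu : u ∈ eigenspace (rabi α γ₁ γ₂ ε) (x : ℂ)) :
    u = ∑ s, inner ℂ (eigenBasis α (N, s)) u • branchVec α γ₁ γ₂ ε N ζ s := by
  obtain ⟨z, rfl⟩ : ∃ z, x = level α N + z := ⟨x - level α N, by ring⟩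
  rw [mem_shiftedInterval_iff, add_sub_cancel_left] at hx
  have hz : |z| ≤ 1 / 2 := abs_le.mpr ⟨hx.1, hx.2.le⟩
  rw [mem_eigenspace_iff_diagEq] at hu
  obtain ⟨h1, h2⟩ := (diagEq_zero_iff (isUnit_pert_of_le hε hz) (parityCLM_eigenBasis α)
    (parityCLM_pert _) u).mp hu
  conv_lhs => rw [h1]
  refine Finset.sum_congr rfl fun s _ => ?_
  rcases mul_eq_zero.mp (h2 s) with h3 | h3
  · rw [h3, zero_smul, zero_smul]
  · rw [branchVec, ← (hroot s z hz).mp h3]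

include hε hζ

theorem inner_branchVec (s t : ℤˣ) :
    inner ℂ (eigenBasis α (N, t)) (branchVec α γ₁ γ₂ ε N ζ s) = if t = s then 1 else 0 := by
  rw [branchVec, inner_inv1 (isUnit_pert_of_le hε (hζ s).le), inner_basis]
  simp

theorem branchVec_ne_zero (s : ℤˣ) : branchVec α γ₁ γ₂ ε N ζ s ≠ 0 := by
  intro h
  have := inner_branchVec (α := α) (N := N) hε hζ s s
  rw [h] at this
  simp at this

theorem linearIndependent_branchVec : LinearIndependent ℂ (branchVec α γ₁ γ₂ ε N ζ) := by
  rw [Fintype.linearIndependent_iff]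
  intro c hc t
  have h := congrArg (fun v => inner ℂ (eigenBasis α (N, t)) v) hc
  simp only [inner_sum, inner_smul_right, inner_branchVec hε hζ, inner_zero_right] at h
  simpa [-UnitsInt.univ] using h

theorem parityCLM_branchVec (s : ℤˣ) : parityCLM (branchVec α γ₁ γ₂ ε N ζ s)
    = ((parityOf (N, s) : ℤ) : ℂ) • branchVec α γ₁ γ₂ ε N ζ s :=
  parity_inv1_basis (isUnit_pert_of_le hε (hζ s).le) (parityCLM_eigenBasis α) (parityCLM_pert _) s

include hroot

theorem branchVec_mem_eigenspace (s : ℤˣ) :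
    branchVec α γ₁ γ₂ ε N ζ s ∈ eigenspace (rabi α γ₁ γ₂ ε) ((level α N + ζ s : ℝ) : ℂ) := by
  rw [mem_eigenspace_iff_diagEq]
  exact diagEq_inv1_basis (isUnit_pert_of_le hε (hζ s).le) (parityCLM_eigenBasis α)
    (parityCLM_pert _) ((hroot s _ (hζ s).le).mpr rfl)

theorem eigenspace_ne_bot (s : ℤˣ) :
    eigenspace (rabi α γ₁ γ₂ ε) ((level α N + ζ s : ℝ) : ℂ) ≠ ⊥ := fun h =>
  branchVec_ne_zero hε hζ s
    ((Submodule.eq_bot_iff _).mp h _ (branchVec_mem_eigenspace hε hζ hroot s))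

theorem rabiSpec_inter : rabiSpec α γ₁ γ₂ ε ∩ shiftedInterval α N
    = range fun s => level α N + ζ s := by
  apply Subset.antisymm
  · rintro x ⟨hx, hxI⟩
    obtain ⟨z, rfl⟩ : ∃ z, x = level α N + z := ⟨x - level α N, by ring⟩
    rw [mem_shiftedInterval_iff, add_sub_cancel_left] at hxI
    have hz : |z| ≤ 1 / 2 := abs_le.mpr ⟨hxI.1, hxI.2.le⟩
    by_contra hne
    apply hx
    obtain ⟨R, hR, h0⟩ := exists_resolvent_of_secular_ne_zero (isUnit_pert_of_le hε hz)
      (parityCLM_eigenBasis α) (parityCLM_pert (γ₁ := γ₁) (γ₂ := γ₂) (ε, z)) (N := N)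
      fun s hs => hne ⟨s, by simp only; rw [(hroot s z hz).mp hs]⟩
    refine mem_resolventSet_of R (fun f => (mem_graph_iff_diagEq N z _ f).mpr (hR f))
      fun u hu => h0 u ?_
    rw [← mem_graph_iff_diagEq, zero_add]
    exact hu
  · rintro _ ⟨s, rfl⟩
    exact ⟨mem_spec_of_eigenspace_ne_bot (eigenspace_ne_bot hε hζ hroot s),
      level_add_mem_shiftedInterval hζ s⟩

theorem eigenCount_top : eigenCount (rabi α γ₁ γ₂ ε) ⊤ (shiftedInterval α N) = 2 := by
  have h : (⨆ x ∈ shiftedInterval α N, eigenspace (rabi α γ₁ γ₂ ε) ((x : ℝ) : ℂ) ⊓ ⊤)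
      = Submodule.span ℂ (range (branchVec α γ₁ γ₂ ε N ζ)) := by
    apply le_antisymm
    · refine iSup₂_le fun x hx u hu => ?_
      rw [eigenspace_eq_sum hε hroot hx hu.1]
      exact Submodule.sum_mem _ fun s _ =>
        Submodule.smul_mem _ _ (Submodule.subset_span (mem_range_self s))
    · rw [Submodule.span_le]
      rintro _ ⟨s, rfl⟩
      exact Submodule.mem_iSup_of_mem _ (Submodule.mem_iSup_of_mem
        (level_add_mem_shiftedInterval hζ s)
        ⟨branchVec_mem_eigenspace hε hζ hroot s, trivial⟩)
  rw [eigenCount, h, toENat_rank_span (linearIndependent_branchVec hε hζ), Fintype.card_units_int]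
  rfl

theorem parityCount_eq_one (p : ℤˣ) : parityCount α γ₁ γ₂ ε p N = 1 := by
  -- This is the unique sign whose basis vector on level `N` has parity `p`.
  set s : ℤˣ := p * (-1) ^ N with hs
  have hp : parityOf (N, s) = p := by
    rw [parityOf, hs, mul_assoc, ← mul_pow]
    simp
  have h : (⨆ x ∈ shiftedInterval α N, eigenspace (rabi α γ₁ γ₂ ε) ((x : ℝ) : ℂ)
      ⊓ paritySector p)
      = Submodule.span ℂ (range fun _ : Unit => branchVec α γ₁ γ₂ ε N ζ s) := by
    apply le_antisymm
    · refine iSup₂_le fun x hx u hu => ?_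
      have h2 := mem_paritySector.mp hu.2
      rw [← hp] at h2
      rw [eigenspace_eq_sum hε hroot hx hu.1, Finset.sum_eq_single s]
      · exact Submodule.smul_mem _ _ (Submodule.subset_span ⟨(), rfl⟩)
      · intro t _ hts
        rw [inner_eq_zero_of_parity (parityCLM_eigenBasis α) hts.symm h2, zero_smul]
      · exact fun h => absurd (Finset.mem_univ s) h
    · rw [Submodule.span_le]
      rintro _ ⟨_, rfl⟩
      refine Submodule.mem_iSup_of_mem _ (Submodule.mem_iSup_of_mem
        (level_add_mem_shiftedInterval hζ s)
        ⟨branchVec_mem_eigenspace hε hζ hroot s, ?_⟩)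
      rw [SetLike.mem_coe, mem_paritySector, parityCLM_branchVec hε hζ, hp]
  have hli : LinearIndependent ℂ fun _ : Unit => branchVec α γ₁ γ₂ ε N ζ s :=
    LinearIndependent.of_subsingleton () (branchVec_ne_zero hε hζ s)
  rw [parityCount, eigenCount, h, toENat_rank_span hli]
  rfl

end Level

/-! ### Labelling of the branches by their slopes, and a common bound on `ε`. -/

/-- The sign of the overlap, as a unit. -/
def overlapSign (α : ℝ) (N : ℕ) : ℤˣ := if 0 ≤ overlap α N then 1 else -1

theorem overlapSign_mul (α : ℝ) (N : ℕ) :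
    ((overlapSign α N : ℤ) : ℝ) * overlap α N = |overlap α N| := by
  rw [overlapSign]
  split_ifs with h
  · simp [abs_of_nonneg h]
  · simp [abs_of_neg (not_le.mp h)]

/-- The perturbed eigenvalues near one level. -/
theorem exists_level_branches (α : ℝ) {γ₁ γ₂ : ℝ} (hγ : γ₂ < γ₁) (N : ℕ) :
    ∃ δ : ℝ, 0 < δ ∧ ∃ lam : ℤˣ → ℝ → ℝ,
      (∀ s, AnalyticOnNhd ℝ (lam s) (Ioo (-δ) δ) ∧ lam s 0 = (N : ℝ) + 1 / 2 ∧
        HasDerivAt (lam s) (firstOrderCoeff α γ₁ γ₂ s N) 0) ∧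
      ∀ ε : ℝ, |ε| < δ →
        (∀ x ∈ rabiSpec α γ₁ γ₂ ε, -(α ^ 2 / 2) ≤ x) ∧
        (∀ p, parityCount α γ₁ γ₂ ε p N = 1) ∧
        rabiSpec α γ₁ γ₂ ε ∩ shiftedInterval α N
          = {lam 1 ε - α ^ 2 / 2, lam (-1) ε - α ^ 2 / 2} ∧
        (∀ s, eigenspace (rabi α γ₁ γ₂ ε) ((lam s ε - α ^ 2 / 2 : ℝ) : ℂ) ≠ ⊥) ∧
        eigenCount (rabi α γ₁ γ₂ ε) ⊤ (shiftedInterval α N) = 2 ∧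
        (ε ≠ 0 → overlap α N ≠ 0 → lam 1 ε ≠ lam (-1) ε) := by
  choose δ₀ hδ₀ ζ hζa hζ0 hζd hζ using fun s =>
    exists_branch (b := eigenBasis α) (N := N) (diagOp_symm γ₁ γ₂) s
  -- The scalar equations are labelled by the sign multiplying the overlap, whereas the slopes are
  -- stated with its absolute value; `σ` converts between the labels.
  set σ : ℤˣ → ℤˣ := fun t => t * overlapSign α N with hσ
  have hderiv : ∀ t, HasDerivAt (fun ε => (N : ℝ) + 1 / 2 + ζ (σ t) ε)
      (firstOrderCoeff α γ₁ γ₂ t N) 0 := by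
    intro t
    refine ((hζd (σ t)).const_add _).congr_deriv ?_
    rw [eigenBasis_apply, inner_eigenVec_diagOp, Complex.ofReal_re, firstOrderCoeff,
      ← overlapSign_mul]
    simp only [hσ]
    push_cast
    ring
  have hdist : overlap α N ≠ 0 → ∀ᶠ ε in nhdsWithin (0 : ℝ) {0}ᶜ, ζ (σ 1) ε ≠ ζ (σ (-1)) ε := by
    intro ho
    -- The difference of the branches vanishes at `0` with nonzero derivative when the overlap is
    -- nonzero, so it has no other zero nearby.
    have h1 := (hderiv 1).sub (hderiv (-1))
    have hne : firstOrderCoeff α γ₁ γ₂ 1 N - firstOrderCoeff α γ₁ γ₂ (-1) N ≠ 0 := by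
      have h2 : 0 < (γ₁ - γ₂) * (|overlap α N| / hermiteNormSq N) :=
        mul_pos (sub_pos.mpr hγ) (div_pos (abs_pos.mpr ho) (hermiteNormSq_pos N))
      simp only [firstOrderCoeff]
      push_cast
      linarith
    filter_upwards [h1.eventually_ne (c := 0) hne] with ε hε h
    exact hε (by simp [h])
  obtain ⟨δ₁, hδ₁, hd⟩ : ∃ δ₁ > 0, ∀ ε : ℝ, |ε| < δ₁ → ε ≠ 0 → overlap α N ≠ 0 →
      ζ (σ 1) ε ≠ ζ (σ (-1)) ε := by
    by_cases ho : overlap α N = 0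
    · exact ⟨1, one_pos, fun ε _ _ h => absurd ho h⟩
    · obtain ⟨δ₁, hδ₁, hb⟩ := Metric.eventually_nhds_iff.mp
        (eventually_nhdsWithin_iff.mp (hdist ho))
      exact ⟨δ₁, hδ₁, fun ε hε h0 _ => hb (by rwa [Real.dist_eq, sub_zero]) h0⟩
  refine ⟨min δ₁ (min (δ₀ 1) (δ₀ (-1))), by simp [hδ₁, hδ₀], fun t ε => N + 1 / 2 + ζ (σ t) ε,
    fun t => ⟨?_, ?_, hderiv t⟩, fun ε hε => ?_⟩
  · have hle : min δ₁ (min (δ₀ 1) (δ₀ (-1))) ≤ δ₀ (σ t) := by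
      rcases Int.units_eq_one_or (σ t) with h | h <;> rw [h] <;> simp
    intro x hx
    exact analyticAt_const.add (hζa (σ t) x ⟨by linarith [hx.1], by linarith [hx.2]⟩)
  · simp [hζ0]
  · rw [lt_min_iff, lt_min_iff] at hε
    have hlt : ∀ s, |ε| < δ₀ s := fun s => by
      rcases Int.units_eq_one_or s with h | h <;> rw [h]
      exacts [hε.2.1, hε.2.2]
    have a1 : |ε| * ‖diagOp γ₁ γ₂‖ ≤ 1 / 10 := (hζ 1 ε (hlt 1)).1
    have a2 : ∀ s, |ζ s ε| < 1 / 2 := fun s => (hζ s ε (hlt s)).2.1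
    have a3 := fun s => (hζ s ε (hlt s)).2.2
    have hlam : ∀ t, (N : ℝ) + 1 / 2 + ζ (σ t) ε - α ^ 2 / 2 = level α N + ζ (σ t) ε := fun t => by
      rw [level]; ring
    simp only [hlam]
    refine ⟨fun x hx => neg_le_of_mem_rabiSpec a1 hx, parityCount_eq_one a1 a2 a3, ?_,
      fun t => eigenspace_ne_bot a1 a2 a3 (σ t), eigenCount_top a1 a2 a3, fun h0 ho h => ?_⟩
    · rw [rabiSpec_inter a1 a2 a3]
      have hsurj : Function.Surjective σ := fun s =>
        ⟨s * (overlapSign α N)⁻¹, inv_mul_cancel_right _ _⟩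
      rw [← hsurj.range_comp]
      ext x
      simp only [mem_range, Function.comp_apply, mem_insert_iff, mem_singleton_iff]
      constructor
      · rintro ⟨t, rfl⟩
        rcases Int.units_eq_one_or t with rfl | rfl
        exacts [Or.inl rfl, Or.inr rfl]
      · rintro (rfl | rfl)
        exacts [⟨1, rfl⟩, ⟨-1, rfl⟩]
    · exact hd ε hε.1 h0 ho (add_left_cancel h)

theorem exists_pos_le {δ : ℕ → ℝ} (hδ : ∀ n, 0 < δ n) (K : ℕ) :
    ∃ c : ℝ, 0 < c ∧ c < 1 ∧ ∀ N ≤ K, c ≤ δ N := by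
  induction K with
  | zero =>
    refine ⟨min (1 / 2) (δ 0), by simp [hδ], by simp; norm_num, fun N hN => ?_⟩
    rw [Nat.le_zero.mp hN]
    exact min_le_right _ _
  | succ K ih =>
    obtain ⟨c, h0, h1, hc⟩ := ih
    refine ⟨min c (δ (K + 1)), by simp [h0, hδ], by simp [h1], fun N hN => ?_⟩
    rcases Nat.le_succ_iff.mp hN with h | rfl
    · exact (min_le_left _ _).trans (hc N h)
    · exact min_le_right _ _

end Spectrum

end QRM

end

theorem corollary4p1 (α : ℝ) (hα : 4 * α ^ 2 ∈ Set.Ioi (0 : ℝ) \ QRM.laguerreZeros) :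
    ∃ k : ℕ → ℕ, StrictMono k ∧
      ∀ γ₁ γ₂ : ℝ, γ₂ < γ₁ → ∀ j : ℕ, ∃ c : ℝ, 0 < c ∧ c < 1 ∧
        -- Braak's conjecture holds on `I_0, …, I_{k j}`
        (∀ ε : ℝ, |ε| < c → QRM.BraakUpTo α γ₁ γ₂ ε (k j)) ∧
        -- the eigenvalues are the predicted ones
        ∃ lam : ℤˣ → ℕ → ℝ → ℝ,
          (∀ s : ℤˣ, ∀ N ≤ k j,
            AnalyticOnNhd ℝ (lam s N) (Set.Ioo (-c) c) ∧
            lam s N 0 = (N : ℝ) + 1 / 2 ∧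
            HasDerivAt (lam s N) (QRM.firstOrderCoeff α γ₁ γ₂ s N) 0) ∧
          ∀ ε : ℝ, |ε| < c →
            (∀ x ∈ QRM.rabiSpec α γ₁ γ₂ ε, -(α ^ 2 / 2) ≤ x) ∧
            ∀ N ≤ k j,
              QRM.rabiSpec α γ₁ γ₂ ε ∩ QRM.shiftedInterval α N
                = {lam 1 N ε - α ^ 2 / 2, lam (-1) N ε - α ^ 2 / 2} ∧
              (∀ s : ℤˣ, QRM.eigenspace (QRM.rabi α γ₁ γ₂ ε)
                ((lam s N ε - α ^ 2 / 2 : ℝ) : ℂ) ≠ ⊥) ∧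
              QRM.eigenCount (QRM.rabi α γ₁ γ₂ ε) ⊤ (QRM.shiftedInterval α N) = 2 ∧
              (ε ≠ 0 → QRM.overlap α N ≠ 0 → lam 1 N ε ≠ lam (-1) N ε) := by
  -- The choice `k j = j` works: each segment involves finitely many levels, and `c` lies below all
  -- of their bounds.
  refine ⟨id, strictMono_id, fun γ₁ γ₂ hγ j => ?_⟩
  choose δ hδ lam hlam hspec using QRM.exists_level_branches α hγ
  obtain ⟨c, hc0, hc1, hc⟩ := QRM.exists_pos_le hδ j
  have hone : ∀ ε : ℝ, |ε| < c → ∀ p : ℤˣ, ∀ N ≤ j, QRM.parityCount α γ₁ γ₂ ε p N = 1 :=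
    fun ε hε p N hN => (hspec N ε (hε.trans_le (hc N hN))).2.1 p
  refine ⟨c, hc0, hc1, fun ε hε => ⟨fun p N hN => ?_, fun p N hN h => ?_, fun p N hN h => ?_⟩,
    fun s N => lam N s, fun s N hN => ?_, fun ε hε => ⟨?_, fun N hN => ?_⟩⟩
  · rw [hone ε hε p N hN]
    exact one_le_two
  · rw [hone ε hε p (N + 1) hN] at h
    exact one_ne_zero h.2
  · rw [hone ε hε p (N + 1) hN] at h
    exact absurd h.2 (by norm_num)
  · obtain ⟨h1, h2, h3⟩ := hlam N s
    exact ⟨h1.mono (Set.Ioo_subset_Ioo (neg_le_neg (hc N hN)) (hc N hN)), h2, h3⟩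
  · exact (hspec 0 ε (hε.trans_le (hc 0 (Nat.zero_le _)))).1
  · exact (hspec N ε (hε.trans_le (hc N hN))).2.2
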